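/- Fix a smooth function $\psi:\mathbb R\to\mathbb R$ with $\operatorname{supp}\psi\subset[-\frac14,\frac54]$ and $\psi=1$ on $[0,1]$, let $\widehat{\Box_n u}(\xi)=\psi(\xi-n)\hat u(\xi)$ for $n\in\mathbb Z$, where $\hat u(\xi)=(2\pi)^{-1/2}\int_{\mathbb R}u(x)e^{ix\xi}\,dx$, and let $M^s_{2,p}(\mathbb R)$ be the space of all $u\in\mathcal S'(\mathbb R)$ with $$\|u\|_{M^s_{2,p}}=\big\|\,(1+n^2)^{s/2}\,\|\Box_n u\|_{L^2(\mathbb R)}\big\|_{\ell^p_n(\mathbb Z)}<\infty .$$ For $j\in\mathbb N$ and real coefficients $c=(c_{k,\alpha,b})$ consider the Cauchy problem $$ i\partial_t u+(-1)^{j+1}\partial_x^{2j}u=\sum_{k=1}^{j}\ \sum_{\substack{b\in\{+,-\}^{2k+1},\ \alpha\in\mathbb N_0^{2k+1}\\ |\alpha|=2(j-k)}} c_{k,\alpha,b}\prod_{i=1}^{2k+1}\partial_x^{\alpha_i}v_{b_i},\qquad u(t=0)=u_0, \tag{1}$$ where $v_+=u$ and $v_-=\overline u$. The equation is called NLS-like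 if $c_{k,\alpha,b}=0$ whenever $b\neq(+,-,+,\dots,-,+)$. A Schwartz solution of (1) on an open interval $I\ni 0$ is a $u\in C(I;\mathcal S(\mathbb R))$ that is differentiable in $t$ and satisfies (1) pointwise on $I\times\mathbb R$. For $T>0$, a map $S:M^s_{2,p}(\mathbb R)\times(-T,T)\to M^s_{2,p}(\mathbb R)$ is called a flow map of (1) if $S(u(0),t)=u(t)$ for every Schwartz solution $u$ on $(-T,T)$ with $u(0)\in M^s_{2,p}(\mathbb R)$ and every $t\in(-T,T)$. **Theorem.** Let $j\ge2$, $2\le p\le\infty$ and $0\le s<\frac{j-1}{2}$. Then there exist an NLS-like equation (i.e. a choice of real coefficients $c_{k,\alpha,b}$ that vanish for $b\ne(+,-,+,\dots,-,+)$) and an $R\geq 0$ such that: 1. For every $T>0$, every flow map $S:M^s_{2,p}(\mathbb R)\times(-T,T)\to M^s_{2,p}(\mathbb R)$ of (1) and every $t\in(-T,T)\setminus\{0\}$, the map $u_0\mapsto S(u_0,t)$ is not uniformly continuous, with respect to the $M^s_{2,p}$ norm, on the bounded set $\{u_0:\|u_0\|_{M^s_{2,p}}\le R\}$. 2. This failure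 already occurs among Schwartz solutions: for every $t\neq0$ there is $\varepsilon>0$ such that for every $\delta>0$ there are Schwartz solutions $u,v$ of the equation on $\mathbb R$ with $\|u(\tau)\|_{M^s_{2,p}}\le R$ and $\|v(\tau)\|_{M^s_{2,p}}\le R$ for all $\tau\in\mathbb R$, $\|u(0)-v(0)\|_{M^s_{2,p}}<\delta$ and $\|u(t)-v(t)\|_{M^s_{2,p}}\ge\varepsilon$. -/

import Mathlib

open scoped ENNReal NNReal SchwartzMap ContDiff ComplexConjugate

noncomputable section

namespace NLSHierarchy

/-- The cut-off functions used in the uniform frequency decomposition. -/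
structure IsFrequencyCutoff (ψ : ℝ → ℝ) : Prop where
  smooth : ContDiff ℝ ∞ ψ
  support : tsupport ψ ⊆ Set.Icc (-(1 / 4)) (5 / 4)
  eq_one : ∀ ξ ∈ Set.Icc (0 : ℝ) 1, ψ ξ = 1

/-- The operator `□ₙ`, i.e. multiplication of the Fourier transform with `ψ(ξ - n)`, where the
Fourier transform is `û(ξ) = (2π)^{-1/2} ∫ u(x) exp(ixξ) dx`. Mathlib's Fourier transform has the
kernel `exp(-2πixη)`, so its variable `η` corresponds to `ξ = -2πη`. -/
def box (ψ : ℝ → ℝ) (n : ℤ) (u : 𝓢'(ℝ, ℂ)) : 𝓢'(ℝ, ℂ) :=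
  TemperedDistribution.fourierMultiplierCLM ℂ
    (fun η : ℝ => ((ψ (-(2 * Real.pi * η) - n) : ℝ) : ℂ)) u

/-- The `L²` norm of a tempered distribution; it is `∞` if the distribution is not an
`L²` function. -/
def lTwoNorm (u : 𝓢'(ℝ, ℂ)) : ℝ≥0∞ :=
  ⨅ (f : MeasureTheory.Lp ℂ 2 (MeasureTheory.volume : MeasureTheory.Measure ℝ))
    (_ : MeasureTheory.Lp.toTemperedDistribution f = u), ‖f‖ₑ

/-- The norm of the modulation space `M^s_{2,p}(ℝ)`: the `ℓ^p(ℤ)` norm of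
`⟨n⟩^s ‖□ₙ u‖_{L²}`, with `⟨n⟩ = (1 + n²)^{1/2}`. -/
def modNorm (ψ : ℝ → ℝ) (s : ℝ) (p : ℝ≥0∞) (u : 𝓢'(ℝ, ℂ)) : ℝ≥0∞ :=
  MeasureTheory.eLpNorm
    (fun n : ℤ => ENNReal.ofReal (Real.sqrt (1 + (n : ℝ) ^ 2) ^ s) * lTwoNorm (box ψ n u))
    p MeasureTheory.Measure.count

/-- The modulation space `M^s_{2,p}(ℝ)`. -/
def ModulationSpace (ψ : ℝ → ℝ) (s : ℝ) (p : ℝ≥0∞) : Type :=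
  {u : 𝓢'(ℝ, ℂ) // modNorm ψ s p u < ⊤}

/-- Uniform continuity, in the `M^s_{2,p}` norm, of a map on a set of elements of `M^s_{2,p}`. -/
def IsUniformlyContinuousOn (ψ : ℝ → ℝ) (s : ℝ) (p : ℝ≥0∞)
    (Φ : ModulationSpace ψ s p → ModulationSpace ψ s p) (A : Set (ModulationSpace ψ s p)) :
    Prop :=
  ∀ ε : ℝ≥0∞, 0 < ε → ∃ δ : ℝ≥0∞, 0 < δ ∧ ∀ a ∈ A, ∀ b ∈ A,
    modNorm ψ s p (a.1 - b.1) < δ → modNorm ψ s p ((Φ a).1 - (Φ b).1) < ε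

/-- Coefficients `c_{k,α,b}`, with `α ∈ ℕ₀^{2k+1}` and `b ∈ {+,-}^{2k+1}` (`true` is `+`). -/
abbrev Coefficients : Type :=
  (k : ℕ) → (Fin (2 * k + 1) → ℕ) → (Fin (2 * k + 1) → Bool) → ℝ

/-- `v_+ = w` and `v_- = conj w`. -/
def signed (w : ℝ → ℂ) (σ : Bool) : ℝ → ℂ :=
  fun x => if σ then w x else conj (w x)

/-- The nonlinearity
`∑_{k=1}^j ∑_{b, |α| = 2(j-k)} c_{k,α,b} ∏_{i=1}^{2k+1} ∂_x^{α_i} v_{b_i}`. -/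
def nonlinearity (j : ℕ) (c : Coefficients) (w : ℝ → ℂ) (x : ℝ) : ℂ :=
  ∑ k ∈ Finset.Icc 1 j, ∑ b : Fin (2 * k + 1) → Bool,
    ∑ α ∈ Finset.piAntidiag (Finset.univ : Finset (Fin (2 * k + 1))) (2 * (j - k)),
      (c k α b : ℂ) * ∏ i, iteratedDeriv (α i) (signed w (b i)) x

/-- The only nonlinear terms are those in which the factors are alternately not conjugated and
conjugated, `b = (+,-,+,…,-,+)`; the indices start at `0`. -/
def IsNLSLike (c : Coefficients) : Prop :=
  ∀ (k : ℕ) (α : Fin (2 * k + 1) → ℕ) (b : Fin (2 * k + 1) → Bool),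
    b ≠ (fun i : Fin (2 * k + 1) => decide (Even i.val)) → c k α b = 0

/-- `u` is a classical solution on the time interval `I`, continuous in time with values in the
Schwartz space, of `i ∂_t u + (-1)^{j+1} ∂_x^{2j} u = F(u)` with the nonlinearity `F` given by the
coefficients `c`. -/
structure IsSchwartzSolution (j : ℕ) (c : Coefficients) (I : Set ℝ) (u : ℝ → 𝓢(ℝ, ℂ)) :
    Prop where
  continuousOn : ContinuousOn u I
  differentiableAt : ∀ t ∈ I, ∀ x : ℝ, DifferentiableAt ℝ (fun τ => u τ x) t
  equation : ∀ t ∈ I, ∀ x : ℝ,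
    Complex.I * deriv (fun τ => u τ x) t
        + (-1 : ℂ) ^ (j + 1) * iteratedDeriv (2 * j) (fun y => u t y) x
      = nonlinearity j c (fun y => u t y) x

/-- A Schwartz function as a tempered distribution. -/
def toDistribution (f : 𝓢(ℝ, ℂ)) : 𝓢'(ℝ, ℂ) :=
  SchwartzMap.toTemperedDistributionCLM ℝ ℂ MeasureTheory.volume f

/-- `S : M^s_{2,p}(ℝ) × (-T,T) → M^s_{2,p}(ℝ)` is a flow map of the Cauchy problem: along every
solution with values in the Schwartz space it gives that solution. -/
def IsFlowMap (j : ℕ) (c : Coefficients) (ψ : ℝ → ℝ) (s : ℝ) (p : ℝ≥0∞) (T : ℝ)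
    (S : ModulationSpace ψ s p × Set.Ioo (-T) T → ModulationSpace ψ s p) : Prop :=
  ∀ u : ℝ → 𝓢(ℝ, ℂ), IsSchwartzSolution j c (Set.Ioo (-T) T) u →
    ∀ a : ModulationSpace ψ s p, a.1 = toDistribution (u 0) →
      ∀ t : Set.Ioo (-T) T, (S (a, t)).1 = toDistribution (u t)

end NLSHierarchy

end

/-!
The equation is a flow of the nonlinear Schrödinger (AKNS) hierarchy. The flows of that
hierarchy are differential polynomials in `u` and `conj u`, given by the recursion behind `flow`;
the flow of order `2j` is the linear term `∂ₓ^{2j} u` plus products of `2k + 1` factors, in which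
the numbers of plain and conjugated factors differ by one and which carry `2(j-k)` derivatives.
Since the factors commute, they can be sorted into the pattern `(+,-,+,…,-,+)`, so the flow is an
NLS-like equation (`exists_hierarchy_coefficients`). Its coefficients depend only on `j`.

If `w = e^{i(Nx+θ)} A sech(A(x - b))` is a sech profile with frequency `N` and amplitude `A`, then
the recursion closes on `w`: every member of the hierarchy is a combination of `w` and `w'` whose
coefficients are those of `λⁿ = pₙ λ + mₙ` for the spectral parameter `λ = N + iA`
(`IsSolitonProfile.evalAt_flow`). Hence each flow moves the profile with some velocity and rotates
its phase with the speed `-Re (N + iA)^{2j}` (`isSchwartzSolution_soliton`).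

A soliton of frequency about `n` and amplitude `A ≤ 1` is a wave packet of width `A⁻¹`, and its norm
in `M^s_{2,p}` is comparable to `⟨n⟩^s A^{1/2}`: it is bounded by this quantity times a Sobolev norm
of the rescaled profile, because `ψ(ξ - m)` sees only the tail of the packet for `m ≠ n`
(`exists_modNorm_wavePacket_le`), and the interval number `n` alone already contains most of the
`L²` norm (`exists_le_modNorm_wavePacket`). Frequencies at distance `1/2` from the integers are used
because the packet then sits in the middle of the region in which `ψ(ξ - n) = 1`.

With `A = a⟨n⟩^{-2s}` these norms are bounded above and below uniformly in `n`. Two solitons with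
amplitudes `A` and `A e^h` are `O(h)`-close at time `0`, while their phase speeds differ by about
`h n^{2j-2} A² ∼ h n^{2j-2-4s}`. For `s < (j-1)/2` the exponent is positive, so for large `n` and
some small `h` the phases are opposite at the given time `t` by the intermediate value theorem
(`exists_opposite_phases`). The two solitons then add up instead of cancelling, wherever they have
moved, and their distance at time `t` is bounded from below (`exists_decoherent_solutions`). A flow
map agrees with these solutions, so it cannot be uniformly continuous.
-/

noncomputable section

namespace NLSHierarchy

section

open MvPolynomial

/-! ### Differential polynomials -/

/-- Differential polynomials with real coefficients in `u` and `conj u`: the variable `(a, true)`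
stands for `∂ₓᵃ u` and `(a, false)` for `∂ₓᵃ (conj u)`. -/
abbrev DiffPoly : Type := MvPolynomial (ℕ × Bool) ℝ

/-- The total derivative `∂ₓ` on differential polynomials. -/
def totalDeriv : Derivation ℝ DiffPoly DiffPoly :=
  mkDerivation ℝ fun i => X (i.1 + 1, i.2)

/-- Complex conjugation on differential polynomials: it exchanges `u` and `conj u`. -/
def conjPoly : DiffPoly →ₐ[ℝ] DiffPoly :=
  rename fun i => (i.1, !i.2)

/-- The value of a differential polynomial along the function `w` at the point `x`. -/
def evalAt (w : ℝ → ℂ) (x : ℝ) : DiffPoly →ₐ[ℝ] ℂ :=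
  aeval fun i => iteratedDeriv i.1 (signed w i.2) x

lemma evalAt_X (w : ℝ → ℂ) (x : ℝ) (i : ℕ × Bool) :
    evalAt w x (X i) = iteratedDeriv i.1 (signed w i.2) x := by
  simp [evalAt]

lemma totalDeriv_X (i : ℕ × Bool) : totalDeriv (X i) = X (i.1 + 1, i.2) := by
  simp [totalDeriv, mkDerivation_X]

lemma signed_true (w : ℝ → ℂ) : signed w true = w := by
  funext
  simp [signed]

lemma signed_false (w : ℝ → ℂ) : signed w false = fun x => conj (w x) := by
  funext
  simp [signed]

lemma contDiff_signed {w : ℝ → ℂ} (hw : ContDiff ℝ ∞ w) (σ : Bool) :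
    ContDiff ℝ ∞ (signed w σ) := by
  cases σ
  · rw [signed_false]
    exact Complex.conjCLE.contDiff.comp hw
  · rwa [signed_true]

lemma signed_not (w : ℝ → ℂ) (σ : Bool) : signed w (!σ) = fun x => conj (signed w σ x) := by
  cases σ <;> simp [signed_true, signed_false]

lemma hasDerivAt_conj {f : ℝ → ℂ} {f' : ℂ} {x : ℝ} (h : HasDerivAt f f' x) :
    HasDerivAt (fun y => conj (f y)) (conj f') x :=
  h.star

lemma iteratedDeriv_conj {w : ℝ → ℂ} (hw : ContDiff ℝ ∞ w) (n : ℕ) :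
    iteratedDeriv n (fun x => conj (w x)) = fun x => conj (iteratedDeriv n w x) := by
  induction n with
  | zero => simp
  | succ n ih =>
    funext x
    rw [iteratedDeriv_succ, ih, iteratedDeriv_succ]
    refine (hasDerivAt_conj (DifferentiableAt.hasDerivAt ?_)).deriv
    exact (hw.differentiable_iteratedDeriv n
      (by exact_mod_cast ENat.natCast_lt_top n)).differentiableAt

lemma hasDerivAt_iteratedDeriv {w : ℝ → ℂ} (hw : ContDiff ℝ ∞ w) (n : ℕ) (x : ℝ) :
    HasDerivAt (iteratedDeriv n w) (iteratedDeriv (n + 1) w x) x := by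
  rw [iteratedDeriv_succ]
  exact (hw.differentiable_iteratedDeriv n
    (by exact_mod_cast ENat.natCast_lt_top n)).differentiableAt.hasDerivAt

lemma hasDerivAt_evalAt {w : ℝ → ℂ} (hw : ContDiff ℝ ∞ w) (P : DiffPoly) (x : ℝ) :
    HasDerivAt (fun y => evalAt w y P) (evalAt w x (totalDeriv P)) x := by
  induction P using MvPolynomial.induction_on with
  | C a =>
    have h : ∀ y, evalAt w y (C a) = (a : ℂ) := fun y => by simp [evalAt]
    simp only [h, totalDeriv, derivation_C, map_zero]
    exact hasDerivAt_const x _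
  | add p q hp hq => simpa only [map_add] using hp.fun_add hq
  | mul_X p i hp =>
    have hX : HasDerivAt (fun y => evalAt w y (X i)) (evalAt w x (X (i.1 + 1, i.2))) x := by
      simp only [evalAt_X]
      exact hasDerivAt_iteratedDeriv (contDiff_signed hw i.2) i.1 x
    simp only [map_mul, Derivation.leibniz, totalDeriv_X, smul_eq_mul, map_add]
    refine (hp.fun_mul hX).congr_deriv ?_
    ring

lemma evalAt_conjPoly {w : ℝ → ℂ} (hw : ContDiff ℝ ∞ w) (P : DiffPoly) (x : ℝ) :
    evalAt w x (conjPoly P) = conj (evalAt w x P) := by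
  induction P using MvPolynomial.induction_on with
  | C a => simp [evalAt, conjPoly]
  | add p q hp hq => simp only [map_add, hp, hq]
  | mul_X p i hp =>
    have h : conjPoly (X i) = X (i.1, !i.2) := by simp [conjPoly]
    rw [map_mul, map_mul, map_mul, map_mul, hp, h, evalAt_X, evalAt_X, signed_not,
      iteratedDeriv_conj (contDiff_signed hw i.2)]

/-! ### The flows of the NLS hierarchy -/

/-- The pairs `(gₙ, eₙ)` of the AKNS recursion. The `gₙ` are the flows of the NLS hierarchy
(`g₂ = ∂ₓ²u + 2|u|²u`). The AKNS matrices have the off-diagonal entries `gₙ` and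
`(-1)ⁿ conj gₙ` up to normalisation, and the `eₙ` are their diagonal entries. The usual recursion
determines `eₙ` by its derivative; here it is read off from the constancy of the determinant
instead, which makes it visibly a differential polynomial. -/
def aknsPair : ℕ → DiffPoly × DiffPoly
  | 0 => (X (0, true), 0)
  | n + 1 =>
    (totalDeriv (aknsPair n).1 - 2 * (aknsPair n).2 * X (0, true),
      ∑ i : Fin (n + 1), ((aknsPair i).2 * (aknsPair (n - i)).2
        - (-1) ^ (i : ℕ) * conjPoly (aknsPair i).1 * (aknsPair (n - i)).1))

/-- The `n`-th flow of the NLS hierarchy, as a differential polynomial. -/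
def flow (n : ℕ) : DiffPoly := (aknsPair n).1

/-- The diagonal entries of the AKNS recursion. -/
def diagEntry (n : ℕ) : DiffPoly := (aknsPair n).2

lemma flow_zero : flow 0 = X (0, true) := by simp [flow, aknsPair]

lemma diagEntry_zero : diagEntry 0 = 0 := by simp [diagEntry, aknsPair]

lemma flow_succ (n : ℕ) :
    flow (n + 1) = totalDeriv (flow n) - 2 * diagEntry n * X (0, true) := by
  simp [flow, diagEntry, aknsPair]

lemma diagEntry_succ (n : ℕ) :
    diagEntry (n + 1) = ∑ i ∈ Finset.range (n + 1), (diagEntry i * diagEntry (n - i)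
        - (-1) ^ i * conjPoly (flow i) * flow (n - i)) := by
  rw [Finset.sum_range]
  simp [flow, diagEntry, aknsPair]

/-- Monomials that are products of pairs `∂ᵃu · ∂ᵇ(conj u)`; the index is the number of derivatives
plus the number of factors. -/
inductive IsEvenMonomial : ℕ → DiffPoly → Prop
  | one : IsEvenMonomial 0 1
  | mul (a b n : ℕ) (f : DiffPoly) (hf : IsEvenMonomial n f) :
      IsEvenMonomial (a + b + 2 + n) (X (a, true) * X (b, false) * f)

/-- The span of the paired monomials of weight `n`. -/
def evenPart (n : ℕ) : Submodule ℝ DiffPoly := Submodule.span ℝ {f | IsEvenMonomial n f}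

/-- The span of the monomials `∂ᵃu · f`, where `f` is a nonconstant paired monomial and the
weights add up to `n`. -/
def oddPart (n : ℕ) : Submodule ℝ DiffPoly :=
  Submodule.span ℝ
    {g | ∃ a m f, IsEvenMonomial m f ∧ 0 < m ∧ a + m = n ∧ g = X (a, true) * f}

lemma IsEvenMonomial.mul_mem {m n : ℕ} {f g : DiffPoly} (hf : IsEvenMonomial m f)
    (hg : IsEvenMonomial n g) : IsEvenMonomial (m + n) (f * g) := by
  induction hf with
  | one => simpa using hg
  | mul a b k f _ ih =>
    have := IsEvenMonomial.mul a b _ _ ih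
    rwa [← add_assoc, ← mul_assoc] at this

lemma IsEvenMonomial.conjPoly {n : ℕ} {f : DiffPoly} (hf : IsEvenMonomial n f) :
    IsEvenMonomial n (conjPoly f) := by
  induction hf with
  | one => simpa using IsEvenMonomial.one
  | mul a b k f _ ih =>
    have := IsEvenMonomial.mul b a _ _ ih
    have h : ∀ i, NLSHierarchy.conjPoly (X i) = X (i.1, !i.2) := by simp [NLSHierarchy.conjPoly]
    rw [map_mul, map_mul, h, h, add_comm a b]
    simpa [mul_comm (X (a, false) : DiffPoly)] using this

lemma mul_mem_evenPart {m n : ℕ} {f g : DiffPoly} (hf : f ∈ evenPart m) (hg : g ∈ evenPart n) :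
    f * g ∈ evenPart (m + n) := by
  refine Submodule.span_mono ?_ (Submodule.mul_mem_mul hf hg |> fun h => by
    rw [evenPart, evenPart, Submodule.span_mul_span] at h; exact h)
  rintro _ ⟨a, ha, b, hb, rfl⟩
  exact IsEvenMonomial.mul_mem ha hb

lemma pair_mul_mem_evenPart (a b : ℕ) {n : ℕ} {f : DiffPoly} (hf : f ∈ evenPart n) :
    X (a, true) * X (b, false) * f ∈ evenPart (a + b + 2 + n) := by
  have h : (X (a, true) * X (b, false) : DiffPoly) ∈ evenPart (a + b + 2) :=
    Submodule.subset_span (by simpa using IsEvenMonomial.mul a b 0 1 .one)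
  exact mul_mem_evenPart h hf

lemma mul_mem_oddPart (a : ℕ) {n : ℕ} {f : DiffPoly} (hn : 0 < n) (hf : f ∈ evenPart n) :
    X (a, true) * f ∈ oddPart (a + n) := by
  induction hf using Submodule.span_induction with
  | mem x h => exact Submodule.subset_span ⟨a, n, x, h, hn, rfl, rfl⟩
  | zero => simp
  | add x y _ _ hx hy => simpa [mul_add] using add_mem hx hy
  | smul c x _ hx => simpa using Submodule.smul_mem _ c hx

lemma totalDeriv_mem_evenPart {n : ℕ} {f : DiffPoly} (hf : f ∈ evenPart n) :
    totalDeriv f ∈ evenPart (n + 1) := by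
  induction hf using Submodule.span_induction with
  | mem x h =>
    induction h with
    | one => simp
    | mul a b k f hf ih =>
      have h1 := pair_mul_mem_evenPart (a + 1) b (Submodule.subset_span hf : f ∈ evenPart k)
      have h2 := pair_mul_mem_evenPart a (b + 1) (Submodule.subset_span hf : f ∈ evenPart k)
      have h3 := pair_mul_mem_evenPart a b ih
      simp only [Derivation.leibniz, totalDeriv_X, smul_eq_mul]
      rw [show a + 1 + b + 2 + k = a + b + 2 + k + 1 by ring] at h1
      rw [show a + (b + 1) + 2 + k = a + b + 2 + k + 1 by ring] at h2
      convert add_mem (add_mem h1 h2) h3 using 1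
      ring
  | zero => simp
  | add x y _ _ hx hy => simpa using add_mem hx hy
  | smul c x _ hx => simpa using Submodule.smul_mem _ c hx

lemma totalDeriv_mem_oddPart {n : ℕ} {f : DiffPoly} (hf : f ∈ oddPart n) :
    totalDeriv f ∈ oddPart (n + 1) := by
  induction hf using Submodule.span_induction with
  | mem x h =>
    obtain ⟨a, m, f, hf, hm, rfl, rfl⟩ := h
    have hf' : f ∈ evenPart m := Submodule.subset_span hf
    have h1 := mul_mem_oddPart (a + 1) hm hf'
    have h2 := mul_mem_oddPart a (Nat.succ_pos m) (totalDeriv_mem_evenPart hf')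
    rw [show a + 1 + m = a + m + 1 by ring] at h1
    simp only [Derivation.leibniz, totalDeriv_X, smul_eq_mul]
    rw [mul_comm f]
    exact add_mem h2 h1
  | zero => simp
  | add x y _ _ hx hy => simpa using add_mem hx hy
  | smul c x _ hx => simpa using Submodule.smul_mem _ c hx

/-- Every odd differential polynomial is a sum `∑ ∂ᵃu · fₐ` with paired `fₐ`; the product of the
conjugate of one with another is therefore paired again. -/
lemma conjPoly_mul_mem_evenPart {m n : ℕ} {f g : DiffPoly}
    (hf : f - X (m, true) ∈ oddPart m) (hg : g - X (n, true) ∈ oddPart n) :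
    conjPoly f * g ∈ evenPart (m + n + 2) := by
  have key : ∀ {n : ℕ} {g : DiffPoly}, g - X (n, true) ∈ oddPart n →
      g ∈ Submodule.span ℝ
        {g | ∃ a m f, IsEvenMonomial m f ∧ a + m = n ∧ g = X (a, true) * f} := by
    intro n g hg
    have h1 : (X (n, true) : DiffPoly) ∈ Submodule.span ℝ
        {g | ∃ a m f, IsEvenMonomial m f ∧ a + m = n ∧ g = X (a, true) * f} :=
      Submodule.subset_span ⟨n, 0, 1, .one, rfl, by simp⟩
    have h2 := Submodule.span_mono (R := ℝ) (by
      rintro _ ⟨a, m, f, hf, -, h, h'⟩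
      exact ⟨a, m, f, hf, h, h'⟩ :
        {g : DiffPoly | ∃ a m f, IsEvenMonomial m f ∧ 0 < m ∧ a + m = n ∧ g = X (a, true) * f} ⊆
        {g | ∃ a m f, IsEvenMonomial m f ∧ a + m = n ∧ g = X (a, true) * f}) hg
    simpa using add_mem h2 h1
  replace hf := key hf
  replace hg := key hg
  clear key
  induction hf using Submodule.span_induction with
  | mem x h =>
    obtain ⟨a, k, f, hf, rfl, rfl⟩ := h
    induction hg using Submodule.span_induction with
    | mem y h =>
      obtain ⟨b, l, g, hg, rfl, rfl⟩ := h
      have h := IsEvenMonomial.mul b a _ _ (IsEvenMonomial.mul_mem (IsEvenMonomial.conjPoly hf) hg)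
      have hX : conjPoly (X (a, true)) = X (a, false) := by simp [conjPoly]
      refine Submodule.subset_span ?_
      rw [show a + k + (b + l) + 2 = b + a + 2 + (k + l) by ring, map_mul, hX]
      rw [show X (a, false) * conjPoly f * (X (b, true) * g) =
        X (b, true) * X (a, false) * (conjPoly f * g) by ring]
      exact h
    | zero => simp
    | add x y _ _ hx hy => simpa [mul_add] using add_mem hx hy
    | smul c x _ hx => simpa using Submodule.smul_mem _ c hx
  | zero => simp
  | add x y _ _ hx hy => simpa [add_mul] using add_mem hx hy
  | smul c x _ hx => simpa using Submodule.smul_mem _ c hx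

lemma flow_mem_and_diagEntry_mem (n : ℕ) :
    flow n - X (n, true) ∈ oddPart n ∧ diagEntry n ∈ evenPart (n + 1) := by
  induction n using Nat.strong_induction_on with
  | _ n ih =>
    match n with
    | 0 => simp [flow_zero, diagEntry_zero]
    | n + 1 =>
      constructor
      · have h1 := totalDeriv_mem_oddPart (ih n (by omega)).1
        have h2 := mul_mem_oddPart 0 (Nat.succ_pos n) (ih n (by omega)).2
        rw [zero_add] at h2
        rw [map_sub, totalDeriv_X] at h1
        rw [flow_succ]
        convert sub_mem h1 (Submodule.smul_mem _ (2 : ℝ) h2) using 1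
        rw [ofNat_smul_eq_nsmul, nsmul_eq_mul]
        push_cast
        ring
      · rw [diagEntry_succ]
        refine sum_mem fun i hi => ?_
        rw [Finset.mem_range] at hi
        have h1 := mul_mem_evenPart (ih i (by omega)).2 (ih (n - i) (by omega)).2
        have h2 := conjPoly_mul_mem_evenPart (ih i (by omega)).1 (ih (n - i) (by omega)).1
        rw [show i + 1 + (n - i + 1) = n + 1 + 1 by omega] at h1
        rw [show i + (n - i) + 2 = n + 1 + 1 by omega] at h2
        refine sub_mem h1 ?_
        rw [mul_assoc]
        rcases neg_one_pow_eq_or DiffPoly i with h | h <;> rw [h]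
        · simpa using h2
        · simpa using h2

/-! ### From differential polynomials to coefficients -/

/-- A paired monomial is a product in which the factors are alternately conjugated and not
conjugated, beginning with a conjugated factor. -/
lemma IsEvenMonomial.exists_eq_prod {n : ℕ} {f : DiffPoly} (hf : IsEvenMonomial n f) :
    ∃ (k : ℕ) (α : Fin (2 * k) → ℕ), 2 * k + ∑ i, α i = n ∧ ∀ w x,
      evalAt w x f = ∏ i, iteratedDeriv (α i) (signed w (decide (Odd i.val))) x := by
  induction hf with
  | one => exact ⟨0, Fin.elim0, by simp, by simp⟩
  | mul a b n f _ ih =>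
    obtain ⟨k, α, rfl, h⟩ := ih
    refine ⟨k + 1, (Fin.cons b (Fin.cons a α : Fin (2 * k + 1) → ℕ) : Fin (2 * k + 1 + 1) → ℕ),
      ?_, fun w x => ?_⟩
    · change 2 * (k + 1) + ∑ i : Fin (2 * k + 1 + 1), _ = _
      simp only [Fin.sum_univ_succ, Fin.cons_zero, Fin.cons_succ]
      ring
    · change _ = ∏ i : Fin (2 * k + 1 + 1), _
      simp only [Fin.prod_univ_succ, Fin.cons_zero, Fin.cons_succ, map_mul, evalAt_X, h,
        Fin.val_zero, Fin.val_succ]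
      simp [Nat.odd_add_one, mul_assoc, mul_left_comm]

open Classical in
lemma nonlinearity_single (j k : ℕ) (hk : k ∈ Finset.Icc 1 j) (α : Fin (2 * k + 1) → ℕ)
    (hα : ∑ i, α i = 2 * (j - k)) (w : ℝ → ℂ) (x : ℝ) :
    nonlinearity j (Pi.single k (Pi.single α (Pi.single
        (fun i : Fin (2 * k + 1) => decide (Even i.val)) 1))) w x
      = ∏ i, iteratedDeriv (α i) (signed w (decide (Even i.val))) x := by
  unfold nonlinearity
  rw [Finset.sum_eq_single_of_mem k hk]
  · rw [Finset.sum_eq_single_of_mem (fun i : Fin (2 * k + 1) => decide (Even i.val))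
      (Finset.mem_univ _)]
    · rw [Finset.sum_eq_single_of_mem α (by simpa using hα)]
      · simp
      · intro β _ hβ
        simp [Pi.single_eq_of_ne hβ]
    · intro b _ hb
      refine Finset.sum_eq_zero fun β _ => ?_
      by_cases hβ : β = α
      · subst hβ
        simp [Pi.single_eq_of_ne hb]
      · simp [Pi.single_eq_of_ne hβ]
  · intro l _ hl
    simp [Pi.single_eq_of_ne hl]

lemma exists_coefficients_of_mem_oddPart (j : ℕ) {P : DiffPoly} (hP : P ∈ oddPart (2 * j)) :
    ∃ c, IsNLSLike c ∧ ∀ w x, nonlinearity j c w x = evalAt w x P := by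
  classical
  induction hP using Submodule.span_induction with
  | mem x h =>
    obtain ⟨a, m, f, hf, hm, ham, rfl⟩ := h
    obtain ⟨k, α, hkα, h⟩ := hf.exists_eq_prod
    have hk : 1 ≤ k := by
      rcases Nat.eq_zero_or_pos k with rfl | h
      · simp at hkα
        omega
      · exact h
    refine ⟨Pi.single k (Pi.single (Fin.cons a α) (Pi.single
        (fun i : Fin (2 * k + 1) => decide (Even i.val)) 1)), ?_, fun w x => ?_⟩
    · intro l β b hb
      by_cases hl : l = k
      · subst hl
        by_cases hβ : β = Fin.cons a α
        · subst hβ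
          simp [Pi.single_eq_of_ne hb]
        · simp [Pi.single_eq_of_ne hβ]
      · simp [Pi.single_eq_of_ne hl]
    · rw [nonlinearity_single j k (by simp; omega) _ (by
        rw [Fin.sum_univ_succ]
        simp only [Fin.cons_zero, Fin.cons_succ]
        omega)]
      rw [Fin.prod_univ_succ, map_mul, evalAt_X, h]
      simp [Nat.even_add_one]
  | zero => exact ⟨0, fun _ _ _ _ => rfl, fun w x => by simp [nonlinearity]⟩
  | add P Q _ _ hP hQ =>
    obtain ⟨c, hc, hc'⟩ := hP
    obtain ⟨d, hd, hd'⟩ := hQ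
    refine ⟨c + d, fun k α b hb => by simp [hc k α b hb, hd k α b hb], fun w x => ?_⟩
    rw [map_add, ← hc', ← hd']
    simp [nonlinearity, add_mul, Finset.sum_add_distrib]
  | smul r P _ hP =>
    obtain ⟨c, hc, hc'⟩ := hP
    refine ⟨r • c, fun k α b hb => by simp [hc k α b hb], fun w x => ?_⟩
    rw [map_smul, ← hc']
    simp [nonlinearity, mul_assoc, Finset.mul_sum]

/-- The coefficients of the `j`-th equation of the NLS hierarchy. -/
lemma exists_hierarchy_coefficients (j : ℕ) :
    ∃ c, IsNLSLike c ∧ ∀ w x, nonlinearity j c w x =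
      (-1) ^ j * (evalAt w x (flow (2 * j)) - iteratedDeriv (2 * j) w x) := by
  obtain ⟨c, hc, h⟩ := exists_coefficients_of_mem_oddPart j
    (Submodule.smul_mem _ ((-1 : ℝ) ^ j) (flow_mem_and_diagEntry_mem (2 * j)).1)
  refine ⟨c, hc, fun w x => ?_⟩
  rw [h, map_smul, map_sub, evalAt_X, signed_true]
  simp

end

/-! ### The hierarchy along solitons -/

/-- The coefficients `(pₙ, mₙ)` with `λⁿ = pₙ λ + mₙ` for `λ = N + iA`. -/
def powCoeff (N A : ℝ) : ℕ → ℝ × ℝ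
  | 0 => (0, 1)
  | n + 1 => (2 * N * (powCoeff N A n).1 + (powCoeff N A n).2,
      -(N ^ 2 + A ^ 2) * (powCoeff N A n).1)

lemma pow_eq_powCoeff (N A : ℝ) (n : ℕ) :
    ((N : ℂ) + A * Complex.I) ^ n
      = (powCoeff N A n).1 * ((N : ℂ) + A * Complex.I) + (powCoeff N A n).2 := by
  induction n with
  | zero => simp [powCoeff]
  | succ n ih =>
    rw [pow_succ, ih]
    simp only [powCoeff]
    push_cast
    linear_combination (-(A : ℂ) ^ 2 * (powCoeff N A n).1 + A ^ 2 * (powCoeff N A n).1 +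
      (powCoeff N A n).1 * A ^ 2) * Complex.I_sq

lemma re_pow_eq_powCoeff (N A : ℝ) (n : ℕ) :
    (((N : ℂ) + A * Complex.I) ^ n).re = N * (powCoeff N A n).1 + (powCoeff N A n).2 := by
  rw [pow_eq_powCoeff]
  simp [mul_comm]

/-- The sum telescopes, since `2N pₘ + mₘ = pₘ₊₁` and `(N² + A²) pₗ = -mₗ₊₁`. -/
lemma sum_powCoeff (N A : ℝ) (n : ℕ) :
    ∑ i ∈ Finset.range (n + 1),
      ((N ^ 2 + A ^ 2) * (powCoeff N A i).1 * (powCoeff N A (n - i)).1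
        + (powCoeff N A i).2 * (powCoeff N A (n - i)).2
        + 2 * N * (powCoeff N A i).1 * (powCoeff N A (n - i)).2) = (powCoeff N A (n + 1)).1 := by
  have h := Finset.sum_range_sub
    (fun i => (powCoeff N A i).1 * (powCoeff N A (n + 1 - i)).2) (n + 1)
  have h0 : powCoeff N A 0 = (0, 1) := rfl
  simp only [Nat.sub_self, h0, zero_mul, sub_zero, mul_one] at h
  rw [← h]
  refine Finset.sum_congr rfl fun i hi => ?_
  rw [Finset.mem_range] at hi
  rw [show n + 1 - (i + 1) = n - i by omega, show n + 1 - i = n - i + 1 by omega]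
  simp only [powCoeff]
  ring

/-- The stationary equations that hold along every soliton with spectral parameter `N + iA`:
the function is `e^{i(Nx+θ)} Q` with a real `Q` such that `Q'' = A² Q - 2 Q³` and
`Q'² = A² Q² - Q⁴`. -/
structure IsSolitonProfile (N A : ℝ) (w w' : ℝ → ℂ) : Prop where
  contDiff : ContDiff ℝ ∞ w
  hasDerivAt : ∀ x, HasDerivAt w (w' x) x
  hasDerivAt_deriv : ∀ x, HasDerivAt w'
    (-2 * (w x * conj (w x)) * w x + 2 * Complex.I * N * w' x + (N ^ 2 + A ^ 2) * w x) x
  deriv_mul_conj : ∀ x, w' x * conj (w' x)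
    = (N ^ 2 + A ^ 2) * (w x * conj (w x)) - (w x * conj (w x)) ^ 2
  momentum : ∀ x, w' x * conj (w x) - w x * conj (w' x) = 2 * Complex.I * N * (w x * conj (w x))

/-- Along a soliton all flows are combinations of `w` and `w'` with constant coefficients: they act
by a phase rotation and a translation. -/
lemma IsSolitonProfile.evalAt_flow {N A : ℝ} {w w' : ℝ → ℂ} (h : IsSolitonProfile N A w w')
    (n : ℕ) (x : ℝ) :
    evalAt w x (flow n) = Complex.I ^ n *
      (-Complex.I * (powCoeff N A n).1 * w' x + (powCoeff N A n).2 * w x) ∧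
    evalAt w x (diagEntry n) = Complex.I ^ (n + 1) * (powCoeff N A n).1 * (w x * conj (w x)) := by
  induction n using Nat.strong_induction_on generalizing x with
  | _ n ih =>
    match n with
    | 0 => simp [flow_zero, diagEntry_zero, evalAt_X, signed_true, powCoeff]
    | n + 1 =>
      have hI := Complex.I_sq
      constructor
      · have h1 : HasDerivAt (fun y => evalAt w y (flow n)) (Complex.I ^ n *
            (-Complex.I * (powCoeff N A n).1 * (-2 * (w x * conj (w x)) * w x
              + 2 * Complex.I * N * w' x + (N ^ 2 + A ^ 2) * w x)
              + (powCoeff N A n).2 * w' x)) x := by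
          rw [funext fun y => (ih n (by omega) y).1]
          exact (((h.hasDerivAt_deriv x).const_mul _).add
            ((h.hasDerivAt x).const_mul _)).const_mul _
        have h2 := (hasDerivAt_evalAt h.contDiff (flow n) x).unique h1
        rw [flow_succ, map_sub, h2, map_mul, map_mul, (ih n (by omega) x).2, evalAt_X]
        simp only [signed_true, iteratedDeriv_zero, powCoeff, map_ofNat]
        push_cast
        linear_combination (Complex.I ^ n * ((powCoeff N A n).2 * w' x)) * hI
      · rw [diagEntry_succ, map_sum]
        have h3 : ∀ i ∈ Finset.range (n + 1),
            evalAt w x (diagEntry i * diagEntry (n - i)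
              - (-1) ^ i * conjPoly (flow i) * flow (n - i))
            = Complex.I ^ (n + 2) * (w x * conj (w x) * (((N ^ 2 + A ^ 2) * (powCoeff N A i).1
                  * (powCoeff N A (n - i)).1 + (powCoeff N A i).2 * (powCoeff N A (n - i)).2 : ℝ))
                + Complex.I * (powCoeff N A i).1 * (powCoeff N A (n - i)).2 * (w x * conj (w' x))
                - Complex.I * (powCoeff N A i).2 * (powCoeff N A (n - i)).1
                  * (w' x * conj (w x))) := by
          intro i hi
          rw [Finset.mem_range] at hi
          rw [map_sub, map_mul, map_mul, map_mul, evalAt_conjPoly h.contDiff,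
            (ih i (by omega) x).1, (ih i (by omega) x).2, (ih (n - i) (by omega) x).1,
            (ih (n - i) (by omega) x).2]
          have hp : Complex.I ^ (n + 2) = Complex.I ^ (i + 1) * Complex.I ^ (n - i + 1) := by
            rw [← pow_add]
            congr 1
            omega
          have hm : (-1 : ℂ) ^ i * conj (Complex.I ^ i) = Complex.I ^ i := by
            rw [map_pow, Complex.conj_I, ← mul_pow]
            simp
          simp only [map_mul, map_add, map_neg, map_pow, map_one, Complex.conj_I,
            Complex.conj_ofReal, neg_neg] at hm ⊢
          rw [hp]
          push_cast
          generalize n - i = l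
          generalize powCoeff N A i = a
          generalize powCoeff N A l = b
          linear_combination
            (-(Complex.I * a.1 * conj (w' x) + a.2 * conj (w x))
              * (Complex.I ^ l * (-Complex.I * b.1 * w' x + b.2 * w x))) * hm
            - (Complex.I ^ i * Complex.I ^ l * a.1 * b.1) * h.deriv_mul_conj x
            + (Complex.I ^ i * Complex.I ^ l * (a.1 * b.1 * (w x * conj (w x)) ^ 2
              + a.1 * b.1 * (w' x * conj (w' x))
              - (w x * conj (w x) * ((N ^ 2 + A ^ 2) * a.1 * b.1 + a.2 * b.2)
                + Complex.I * a.1 * b.2 * (w x * conj (w' x))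
                - Complex.I * a.2 * b.1 * (w' x * conj (w x))))) * hI
        rw [Finset.sum_congr rfl h3, ← Finset.mul_sum, Finset.sum_sub_distrib,
          Finset.sum_add_distrib]
        have h4 : ∑ i ∈ Finset.range (n + 1), Complex.I * (powCoeff N A i).2
              * (powCoeff N A (n - i)).1 * (w' x * conj (w x))
            = ∑ i ∈ Finset.range (n + 1), Complex.I * (powCoeff N A (n - i)).2
              * (powCoeff N A i).1 * (w' x * conj (w x)) := by
          rw [← Finset.sum_range_reflect]
          refine Finset.sum_congr rfl fun i hi => ?_
          rw [Finset.mem_range] at hi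
          rw [show n + 1 - 1 - i = n - i by omega, show n - (n - i) = i by omega]
        rw [h4, ← sum_powCoeff, add_sub_assoc, ← Finset.sum_sub_distrib, ← Finset.sum_add_distrib,
          mul_assoc]
        congr 1
        push_cast
        rw [Finset.sum_mul]
        refine Finset.sum_congr rfl fun i _ => ?_
        linear_combination (-Complex.I * (powCoeff N A i).1 * (powCoeff N A (n - i)).2)
          * h.momentum x - (2 * N * (powCoeff N A i).1 * (powCoeff N A (n - i)).2
          * (w x * conj (w x))) * hI

section

open scoped Topology
open Filter

/-! ### The hyperbolic secant as a Schwartz function -/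

lemma hasDerivAt_tanh (x : ℝ) : HasDerivAt Real.tanh (1 - Real.tanh x ^ 2) x := by
  have hc := (Real.cosh_pos x).ne'
  rw [funext Real.tanh_eq_sinh_div_cosh]
  refine ((Real.hasDerivAt_sinh x).div (Real.hasDerivAt_cosh x) hc).congr_deriv ?_
  field_simp

lemma hasDerivAt_inv_cosh (x : ℝ) :
    HasDerivAt (fun y => (Real.cosh y)⁻¹) (-((Real.cosh x)⁻¹ * Real.tanh x)) x := by
  have hc := (Real.cosh_pos x).ne'
  refine ((Real.hasDerivAt_cosh x).inv hc).congr_deriv ?_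
  rw [Real.tanh_eq_sinh_div_cosh]
  field_simp

lemma one_sub_tanh_sq (x : ℝ) : 1 - Real.tanh x ^ 2 = (Real.cosh x)⁻¹ ^ 2 := by
  have hc := (Real.cosh_pos x).ne'
  have := Real.cosh_sq_sub_sinh_sq x
  rw [Real.tanh_eq_sinh_div_cosh]
  field_simp
  linarith

/-- All derivatives of the hyperbolic secant are of the form `sech · P(tanh)`. -/
lemma exists_iteratedDeriv_sech (n : ℕ) : ∃ P : Polynomial ℝ,
    iteratedDeriv n (fun x : ℝ => (((Real.cosh x)⁻¹ : ℝ) : ℂ))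
      = fun x => (((Real.cosh x)⁻¹ * P.eval (Real.tanh x) : ℝ) : ℂ) := by
  induction n with
  | zero => exact ⟨1, by simp⟩
  | succ n ih =>
    obtain ⟨P, hP⟩ := ih
    refine ⟨-(Polynomial.X * P) + (1 - Polynomial.X ^ 2) * Polynomial.derivative P, ?_⟩
    funext x
    rw [iteratedDeriv_succ, hP]
    have h := (hasDerivAt_inv_cosh x).fun_mul
      ((P.hasDerivAt (Real.tanh x)).comp x (hasDerivAt_tanh x))
    refine (h.ofReal_comp.congr_deriv ?_).deriv
    simp only [Polynomial.eval_add, Polynomial.eval_neg, Polynomial.eval_mul, Polynomial.eval_X,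
      Polynomial.eval_sub, Polynomial.eval_one, Polynomial.eval_pow, Function.comp]
    push_cast
    ring

lemma inv_cosh_pos (x : ℝ) : 0 < (Real.cosh x)⁻¹ := inv_pos.2 (Real.cosh_pos x)

lemma abs_pow_mul_inv_cosh_le (k : ℕ) (x : ℝ) :
    |x| ^ k * (Real.cosh x)⁻¹ ≤ 2 * k.factorial := by
  have h1 : |x| ^ k / k.factorial ≤ Real.exp |x| := Real.pow_div_factorial_le_exp _ (abs_nonneg x) k
  have h2 : Real.exp |x| ≤ 2 * Real.cosh x := by
    rw [← Real.cosh_abs, Real.cosh_eq]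
    linarith [Real.exp_pos (-|x|)]
  rw [div_le_iff₀ (by positivity)] at h1
  rw [mul_inv_le_iff₀ (Real.cosh_pos x)]
  nlinarith [(Nat.cast_pos (α := ℝ)).2 k.factorial_pos]

lemma contDiff_sech : ContDiff ℝ ∞ (fun x : ℝ => (((Real.cosh x)⁻¹ : ℝ) : ℂ)) :=
  Complex.ofRealCLM.contDiff.comp (Real.contDiff_cosh.inv fun x => (Real.cosh_pos x).ne')

/-- The hyperbolic secant. -/
def sech : 𝓢(ℝ, ℂ) where
  toFun x := (((Real.cosh x)⁻¹ : ℝ) : ℂ)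
  smooth' := contDiff_sech
  decay' k n := by
    obtain ⟨P, hP⟩ := exists_iteratedDeriv_sech n
    obtain ⟨C, hC⟩ := (isCompact_Icc (a := (-1 : ℝ)) (b := 1)).exists_bound_of_continuousOn
      P.continuous.continuousOn
    refine ⟨2 * k.factorial * C, fun x => ?_⟩
    have h1 := abs_pow_mul_inv_cosh_le k x
    have h2 := hC (Real.tanh x) ⟨(Real.neg_one_lt_tanh x).le, (Real.tanh_lt_one x).le⟩
    rw [norm_iteratedFDeriv_eq_norm_iteratedDeriv, hP, Complex.norm_real, norm_mul,
      Real.norm_eq_abs x, Real.norm_of_nonneg (inv_cosh_pos x).le, ← mul_assoc]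
    exact mul_le_mul h1 h2 (norm_nonneg _) (by positivity)

lemma sech_apply (x : ℝ) : sech x = (((Real.cosh x)⁻¹ : ℝ) : ℂ) := rfl

/-! ### Translations and dilations of Schwartz functions -/

/-- Pointwise convergence of all derivatives, locally uniformly in space, together with locally
bounded seminorms, gives continuity with values in the Schwartz space. -/
lemma continuousAt_schwartz {F : ℝ → 𝓢(ℝ, ℂ)} {t₀ : ℝ}
    (hF : ∀ n : ℕ, Continuous fun z : ℝ × ℝ => iteratedDeriv n (F z.1) z.2)
    (hb : ∀ k n : ℕ, ∃ C : ℝ, ∀ᶠ t in 𝓝 t₀, ∀ x : ℝ, |x| ^ k * ‖iteratedDeriv n (F t) x‖ ≤ C) :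
    ContinuousAt F t₀ := by
  have hsub : ∀ (n : ℕ) (t x : ℝ), iteratedDeriv n (F t - F t₀) x
      = iteratedDeriv n (F t) x - iteratedDeriv n (F t₀) x := fun n t x =>
    iteratedDeriv_sub ((F t).smooth n).contDiffAt ((F t₀).smooth n).contDiffAt
  rw [ContinuousAt, (schwartz_withSeminorms ℝ ℝ ℂ).tendsto_nhds]
  rintro ⟨k, n⟩ ε hε
  obtain ⟨C, hC⟩ := hb (k + 1) n
  have hC0 : 0 ≤ C := by
    have := hC.self_of_nhds 0
    simpa using this
  have hM : 0 < 4 * C / ε + 1 := by positivity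
  have hloc : ∀ᶠ t in 𝓝 t₀, ∀ x ∈ Set.Icc (-(4 * C / ε + 1)) (4 * C / ε + 1),
      |x| ^ k * ‖iteratedDeriv n (F t) x - iteratedDeriv n (F t₀) x‖ < ε / 2 := by
    refine isCompact_Icc.eventually_forall_of_forall_eventually fun x _ => ?_
    have hcont : Continuous fun z : ℝ × ℝ =>
        |z.2| ^ k * ‖iteratedDeriv n (F z.1) z.2 - iteratedDeriv n (F t₀) z.2‖ := by
      refine (continuous_snd.abs.pow k).mul (((hF n).sub ?_).norm)
      exact (hF n).comp (continuous_const.prodMk continuous_snd)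
    refine hcont.continuousAt.eventually_lt continuousAt_const ?_
    simpa using hε
  filter_upwards [hC, hloc] with t ht hlt
  refine (SchwartzMap.seminorm_le_bound' ℝ k n _ (half_pos hε).le fun x => ?_).trans_lt
    (half_lt_self hε)
  change |x| ^ k * ‖iteratedDeriv n (F t - F t₀) x‖ ≤ ε / 2
  rw [hsub]
  by_cases hx : |x| ≤ 4 * C / ε + 1
  · exact (hlt x (abs_le.1 hx)).le
  · push Not at hx
    have h1 := ht x
    have h2 := hC.self_of_nhds x
    have h3 : |x| ^ (k + 1) * ‖iteratedDeriv n (F t) x - iteratedDeriv n (F t₀) x‖ ≤ 2 * C := by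
      calc _ ≤ |x| ^ (k + 1) * (‖iteratedDeriv n (F t) x‖ + ‖iteratedDeriv n (F t₀) x‖) := by
            gcongr
            exact norm_sub_le _ _
        _ ≤ 2 * C := by linarith
    have hx0 : 4 * C / ε < |x| := by linarith
    rw [div_lt_iff₀ hε] at hx0
    have hxp : 0 < |x| := hM.trans hx
    rw [pow_succ, mul_right_comm] at h3
    by_contra! h4
    nlinarith [mul_lt_mul_of_pos_right h4 hxp]

/-- Translation `r ↦ r(· - b)`. -/
def translate (b : ℝ) : 𝓢(ℝ, ℂ) →L[ℂ] 𝓢(ℝ, ℂ) := SchwartzMap.compSubConstCLM ℂ b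

lemma translate_apply (b : ℝ) (r : 𝓢(ℝ, ℂ)) (x : ℝ) : translate b r x = r (x - b) := rfl

/-- Dilation `r ↦ r(κ ·)` with `κ ≠ 0`. -/
def dilate (κ : ℝ) (hκ : κ ≠ 0) : 𝓢(ℝ, ℂ) →L[ℂ] 𝓢(ℝ, ℂ) :=
  SchwartzMap.compCLMOfContinuousLinearEquiv ℂ
    (ContinuousLinearEquiv.unitsEquivAut ℝ (Units.mk0 κ hκ))

lemma dilate_apply (κ : ℝ) (hκ : κ ≠ 0) (r : 𝓢(ℝ, ℂ)) (x : ℝ) : dilate κ hκ r x = r (κ * x) := by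
  simp [dilate, mul_comm]

lemma continuous_iteratedDeriv_schwartz (r : 𝓢(ℝ, ℂ)) (n : ℕ) :
    Continuous (iteratedDeriv n r) :=
  (r.smooth n).continuous_iteratedDeriv n le_rfl

lemma continuous_translate (r : 𝓢(ℝ, ℂ)) : Continuous fun b => translate b r := by
  have hd : ∀ (n : ℕ) (b x : ℝ), iteratedDeriv n (translate b r) x = iteratedDeriv n r (x - b) := by
    intro n b x
    rw [show (translate b r : ℝ → ℂ) = fun z => r (z - b) from rfl, iteratedDeriv_comp_sub_const]
  refine continuous_iff_continuousAt.2 fun b₀ => continuousAt_schwartz (fun n => ?_) fun k n => ?_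
  · simp only [hd]
    exact (continuous_iteratedDeriv_schwartz r n).comp (continuous_snd.sub continuous_fst)
  · obtain ⟨C₁, h₁⟩ := r.decay 0 n
    obtain ⟨C₂, h₂⟩ := r.decay k n
    refine ⟨2 ^ k * (C₂ + (|b₀| + 1) ^ k * C₁), ?_⟩
    filter_upwards [Metric.ball_mem_nhds b₀ one_pos] with b hb x
    rw [hd]
    have h₁ := h₁.2 (x - b)
    have h₂ := h₂.2 (x - b)
    rw [norm_iteratedFDeriv_eq_norm_iteratedDeriv, Real.norm_eq_abs] at h₁ h₂
    rw [pow_zero, one_mul] at h₁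
    have hb' : |b| ≤ |b₀| + 1 := by
      rw [Metric.mem_ball, Real.dist_eq] at hb
      linarith [abs_sub_abs_le_abs_sub b b₀]
    have hx : |x| ≤ |x - b| + (|b₀| + 1) := by
      linarith [abs_sub_abs_le_abs_sub x b]
    calc |x| ^ k * ‖iteratedDeriv n r (x - b)‖
        ≤ (|x - b| + (|b₀| + 1)) ^ k * ‖iteratedDeriv n r (x - b)‖ := by gcongr
      _ ≤ (2 ^ (k - 1) * (|x - b| ^ k + (|b₀| + 1) ^ k)) * ‖iteratedDeriv n r (x - b)‖ := by
          gcongr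
          exact add_pow_le (abs_nonneg _) (by positivity) k
      _ ≤ (2 ^ k * (|x - b| ^ k + (|b₀| + 1) ^ k)) * ‖iteratedDeriv n r (x - b)‖ := by
          gcongr
          · norm_num
          · omega
      _ = 2 ^ k * (|x - b| ^ k * ‖iteratedDeriv n r (x - b)‖
            + (|b₀| + 1) ^ k * ‖iteratedDeriv n r (x - b)‖) := by ring
      _ ≤ _ := by gcongr

lemma continuous_dilate_exp (r : 𝓢(ℝ, ℂ)) :
    Continuous fun h : ℝ => dilate (Real.exp h) (Real.exp_ne_zero h) r := by
  have hd : ∀ (n : ℕ) (h x : ℝ), iteratedDeriv n (dilate (Real.exp h) (Real.exp_ne_zero h) r) x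
      = Real.exp h ^ n • iteratedDeriv n r (Real.exp h * x) := by
    intro n h x
    rw [show (dilate (Real.exp h) (Real.exp_ne_zero h) r : ℝ → ℂ) = fun z => r (Real.exp h * z) from
      funext fun z => dilate_apply _ _ r z, iteratedDeriv_comp_const_smul (r.smooth n)]
  refine continuous_iff_continuousAt.2 fun h₀ => continuousAt_schwartz (fun n => ?_) fun k n => ?_
  · simp only [hd]
    have he : Continuous fun z : ℝ × ℝ => Real.exp z.1 := Real.continuous_exp.comp continuous_fst
    exact (he.pow n).smul
      ((continuous_iteratedDeriv_schwartz r n).comp (he.mul continuous_snd))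
  · obtain ⟨C, -, hC⟩ := r.decay k n
    refine ⟨Real.exp (-(h₀ - 1)) ^ k * Real.exp (h₀ + 1) ^ n * C, ?_⟩
    filter_upwards [Metric.ball_mem_nhds h₀ one_pos] with h hh x
    rw [Metric.mem_ball, Real.dist_eq, abs_lt] at hh
    have hC := hC (Real.exp h * x)
    rw [norm_iteratedFDeriv_eq_norm_iteratedDeriv, norm_mul,
      Real.norm_of_nonneg (Real.exp_pos h).le, Real.norm_eq_abs] at hC
    rw [hd, norm_smul, norm_pow, Real.norm_of_nonneg (Real.exp_pos h).le]
    have hx : |x| = Real.exp (-h) * (Real.exp h * |x|) := by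
      rw [← mul_assoc, ← Real.exp_add]
      simp
    calc |x| ^ k * (Real.exp h ^ n * ‖iteratedDeriv n r (Real.exp h * x)‖)
        = Real.exp (-h) ^ k * Real.exp h ^ n *
            ((Real.exp h * |x|) ^ k * ‖iteratedDeriv n r (Real.exp h * x)‖) := by
          rw [hx, mul_pow (Real.exp (-h)), ← hx]
          ring
      _ ≤ Real.exp (-(h₀ - 1)) ^ k * Real.exp (h₀ + 1) ^ n * C := by
          gcongr <;> linarith

lemma contDiff_exp_mul_I (N θ : ℝ) :
    ContDiff ℝ ∞ fun x : ℝ => Complex.exp (Complex.I * (N * x + θ)) :=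
  Complex.contDiff_exp.comp (contDiff_const.mul
    ((contDiff_const.mul Complex.ofRealCLM.contDiff).add contDiff_const))

lemma iteratedDeriv_exp_mul_I (N : ℝ) (n : ℕ) :
    iteratedDeriv n (fun x : ℝ => Complex.exp (Complex.I * N * x))
      = fun x : ℝ => (Complex.I * N) ^ n * Complex.exp (Complex.I * N * x) := by
  induction n with
  | zero => simp
  | succ n ih =>
    funext x
    rw [iteratedDeriv_succ, ih]
    have h : HasDerivAt (fun x : ℝ => Complex.I * N * (x : ℂ)) (Complex.I * N * 1) x :=
      (hasDerivAt_id x).ofReal_comp.const_mul _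
    refine ((h.cexp.const_mul _).congr_deriv ?_).deriv
    ring

lemma norm_exp_mul_I (N x : ℝ) : ‖Complex.exp (Complex.I * N * x)‖ = 1 := by
  rw [show Complex.I * N * x = ((N * x : ℝ) : ℂ) * Complex.I by push_cast; ring]
  exact Complex.norm_exp_ofReal_mul_I _

lemma hasTemperateGrowth_exp_mul_I (N : ℝ) :
    Function.HasTemperateGrowth fun x : ℝ => Complex.exp (Complex.I * N * x) := by
  refine ⟨by simpa [mul_assoc] using contDiff_exp_mul_I N 0, fun n => ⟨0, |N| ^ n, fun x => ?_⟩⟩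
  rw [norm_iteratedFDeriv_eq_norm_iteratedDeriv, iteratedDeriv_exp_mul_I, norm_mul, norm_exp_mul_I]
  simp

/-- The wave packet `x ↦ e^{iNx} A r(Ax)` of frequency `N`, width `A⁻¹` and shape `r`. -/
def wavePacket (N A : ℝ) (hA : A ≠ 0) : 𝓢(ℝ, ℂ) →L[ℂ] 𝓢(ℝ, ℂ) :=
  (SchwartzMap.smulLeftCLM ℂ fun x : ℝ => Complex.exp (Complex.I * N * x)) ∘L
    ((A : ℂ) • dilate A hA)

lemma wavePacket_apply (N A : ℝ) (hA : A ≠ 0) (r : 𝓢(ℝ, ℂ)) (x : ℝ) :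
    wavePacket N A hA r x = Complex.exp (Complex.I * N * x) * (A * r (A * x)) := by
  simp [wavePacket, SchwartzMap.smulLeftCLM_apply_apply (hasTemperateGrowth_exp_mul_I N),
    dilate_apply, mul_left_comm]

/-- The rescaled soliton `y ↦ e^{iθ} e^h sech(e^h (y - b))`. -/
def solitonShape (h θ b : ℝ) : 𝓢(ℝ, ℂ) :=
  (Complex.exp (Complex.I * θ) * Real.exp h) •
    translate b (dilate (Real.exp h) (Real.exp_ne_zero h) sech)

lemma solitonShape_apply (h θ b y : ℝ) : solitonShape h θ b y
    = Complex.exp (Complex.I * θ) * Real.exp h * ((Real.cosh (Real.exp h * (y - b)))⁻¹ : ℝ) := by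
  simp [solitonShape, translate_apply, dilate_apply, sech_apply]

/-! ### Soliton solutions -/

lemma isSolitonProfile_sech (N A θ c : ℝ) {w : ℝ → ℂ}
    (hw : ∀ x, w x = Complex.exp (Complex.I * (N * x + θ)) *
      ((A * (Real.cosh (A * (x - c)))⁻¹ : ℝ) : ℂ)) :
    IsSolitonProfile N A w (fun x => Complex.I * N * w x + Complex.exp (Complex.I * (N * x + θ)) *
      ((-(A ^ 2 * ((Real.cosh (A * (x - c)))⁻¹ * Real.tanh (A * (x - c)))) : ℝ) : ℂ)) := by
  have hlin : ∀ x, HasDerivAt (fun x => A * (x - c)) A x := fun x => by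
    simpa using ((hasDerivAt_id x).sub_const c).const_mul A
  have hS : ∀ x, HasDerivAt (fun x => (Real.cosh (A * (x - c)))⁻¹)
      (-((Real.cosh (A * (x - c)))⁻¹ * Real.tanh (A * (x - c))) * A) x := fun x =>
    HasDerivAt.comp (h₂ := fun y => (Real.cosh y)⁻¹) x (hasDerivAt_inv_cosh _) (hlin x)
  have hT : ∀ x, HasDerivAt (fun x => Real.tanh (A * (x - c)))
      ((1 - Real.tanh (A * (x - c)) ^ 2) * A) x := fun x =>
    HasDerivAt.comp (h₂ := Real.tanh) x (hasDerivAt_tanh _) (hlin x)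
  have hE : ∀ x : ℝ, HasDerivAt (fun x : ℝ => Complex.exp (Complex.I * (N * x + θ)))
      (Complex.exp (Complex.I * (N * x + θ)) * (Complex.I * (N * 1))) x := fun x =>
    ((((hasDerivAt_id x).ofReal_comp.const_mul (N : ℂ)).add_const (θ : ℂ)).const_mul
      Complex.I).cexp
  have hEE : ∀ x : ℝ, Complex.exp (Complex.I * (N * x + θ)) *
      conj (Complex.exp (Complex.I * (N * x + θ))) = 1 := fun x => by
    rw [Complex.mul_conj, Complex.normSq_eq_norm_sq,
      show Complex.I * (N * x + θ) = ((N * x + θ : ℝ) : ℂ) * Complex.I by push_cast; ring,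
      Complex.norm_exp_ofReal_mul_I]
    simp
  have hTS : ∀ x, (1 : ℂ) - (Real.tanh (A * (x - c)) : ℂ) ^ 2
      = ((Real.cosh (A * (x - c)))⁻¹ : ℝ) ^ 2 := fun x => by
    exact_mod_cast one_sub_tanh_sq (A * (x - c))
  have hd : ∀ x, HasDerivAt w (Complex.I * N * w x + Complex.exp (Complex.I * (N * x + θ)) *
      ((-(A ^ 2 * ((Real.cosh (A * (x - c)))⁻¹ * Real.tanh (A * (x - c)))) : ℝ) : ℂ)) x := by
    intro x
    have h := (hE x).fun_mul ((hS x).const_mul A).ofReal_comp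
    rw [← funext hw] at h
    refine h.congr_deriv ?_
    rw [hw]
    push_cast
    ring
  have hI := Complex.I_sq
  refine ⟨?_, hd, fun x => ?_, fun x => ?_, fun x => ?_⟩
  · rw [funext hw]
    have h1 : ContDiff ℝ ∞ fun x : ℝ => (Real.cosh (A * (x - c)))⁻¹ :=
      (Real.contDiff_cosh.comp (by fun_prop)).inv fun x => (Real.cosh_pos _).ne'
    have h2 : ContDiff ℝ ∞ fun x : ℝ => ((A * (Real.cosh (A * (x - c)))⁻¹ : ℝ) : ℂ) :=
      Complex.ofRealCLM.contDiff.comp (contDiff_const.mul h1)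
    have h3 : ContDiff ℝ ∞ fun x : ℝ => Complex.exp (Complex.I * (N * x + θ)) :=
      contDiff_exp_mul_I N θ
    exact h3.mul h2
  · have h1 := ((hd x).const_mul (Complex.I * N)).fun_add
      ((hE x).fun_mul (((hS x).fun_mul (hT x)).const_mul (A ^ 2)).fun_neg.ofReal_comp)
    refine h1.congr_deriv ?_
    have h2 := hEE x
    have h3 := hTS x
    simp only [hw, map_mul, Complex.conj_ofReal]
    push_cast at h3 ⊢
    generalize Complex.exp (Complex.I * (N * x + θ)) = E at *
    generalize (conj E : ℂ) = E' at *
    generalize (Complex.cosh (A * (x - c)))⁻¹ = S at *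
    generalize Complex.tanh (A * (x - c)) = T at *
    linear_combination (-(N ^ 2 * E * A * S)) * hI + (2 * A ^ 3 * S ^ 3 * E) * h2
      - (2 * A ^ 3 * S * E) * h3
  · have h2 := hEE x
    have h3 := hTS x
    simp only [hw, map_mul, map_add, Complex.conj_ofReal, Complex.conj_I]
    push_cast at h3 ⊢
    generalize Complex.exp (Complex.I * (N * x + θ)) = E at *
    generalize (conj E : ℂ) = E' at *
    generalize (Complex.cosh (A * (x - c)))⁻¹ = S at *
    generalize Complex.tanh (A * (x - c)) = T at *
    linear_combination (-(E * E' * N ^ 2 * A ^ 2 * S ^ 2)) * hI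
      - (E * E' * A ^ 4 * S ^ 2) * h3 + (E * E' * A ^ 4 * S ^ 4) * h2
  · simp only [hw, map_mul, map_add, Complex.conj_ofReal, Complex.conj_I]
    ring

/-- The soliton with spectral parameter `N + iAe^h`, which moves with velocity `v` and rotates its
phase with frequency `φ`, in the scale of the wave packets of width `A⁻¹`. -/
def soliton (N A : ℝ) (hA : A ≠ 0) (h φ v t : ℝ) : 𝓢(ℝ, ℂ) :=
  wavePacket N A hA (solitonShape h (φ * t) (A * v * t))

lemma soliton_apply (N A : ℝ) (hA : A ≠ 0) (h φ v t x : ℝ) :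
    soliton N A hA h φ v t x = Complex.exp (Complex.I * (N * x + (φ * t : ℝ))) *
      ((A * Real.exp h * (Real.cosh (A * Real.exp h * (x - v * t)))⁻¹ : ℝ) : ℂ) := by
  rw [soliton, wavePacket_apply, solitonShape_apply, mul_add, Complex.exp_add,
    show Real.exp h * (A * x - A * v * t) = A * Real.exp h * (x - v * t) by ring,
    ← mul_assoc Complex.I]
  generalize (Real.cosh (A * Real.exp h * (x - v * t)))⁻¹ = S
  push_cast
  ring

lemma continuous_solitonShape (h φ v : ℝ) :
    Continuous fun t => solitonShape h (φ * t) (v * t) := by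
  have h1 : Continuous fun t : ℝ => Complex.exp (Complex.I * (φ * t : ℝ)) * Real.exp h := by
    fun_prop
  exact h1.smul ((continuous_translate _).comp (continuous_const.mul continuous_id))

/-- The flow of order `2j` acts on the soliton with spectral parameter `λ = N + iAe^h` through
`λ^{2j} = p λ + m`: the soliton moves with velocity `p` and its phase rotates with the frequency
`-Re λ^{2j} = -(N p + m)`. -/
lemma isSchwartzSolution_soliton {j : ℕ} {c : Coefficients}
    (hc : ∀ w x, nonlinearity j c w x =
      (-1) ^ j * (evalAt w x (flow (2 * j)) - iteratedDeriv (2 * j) w x))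
    (N A : ℝ) (hA : A ≠ 0) (h : ℝ) :
    IsSchwartzSolution j c Set.univ (soliton N A hA h
      (-(((N : ℂ) + (A * Real.exp h : ℝ) * Complex.I) ^ (2 * j)).re)
      (powCoeff N (A * Real.exp h) (2 * j)).1) := by
  rw [re_pow_eq_powCoeff]
  set B := A * Real.exp h with hB
  set p := (powCoeff N B (2 * j)).1 with hp
  set m := (powCoeff N B (2 * j)).2 with hm
  set φ := -(N * p + m) with hφ
  have hx : ∀ t x : ℝ, soliton N A hA h φ p t x
      = Complex.exp (Complex.I * (N * x + (φ * t : ℝ))) *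
        ((B * (Real.cosh (B * (x - p * t)))⁻¹ : ℝ) : ℂ) := soliton_apply N A hA h φ p
  have hderiv : ∀ t x : ℝ, HasDerivAt (fun τ => soliton N A hA h φ p τ x)
      (Complex.I * φ * soliton N A hA h φ p t x - p * (Complex.exp (Complex.I *
        (N * x + (φ * t : ℝ))) * ((-(B ^ 2 * ((Real.cosh (B * (x - p * t)))⁻¹ *
          Real.tanh (B * (x - p * t)))) : ℝ) : ℂ))) t := by
    intro t x
    have h1 : HasDerivAt (fun t => B * (x - p * t)) (B * -p) t := by
      simpa using (((hasDerivAt_id t).const_mul p).const_sub x).const_mul B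
    have h2 := ((HasDerivAt.comp (h₂ := fun y => (Real.cosh y)⁻¹) t (hasDerivAt_inv_cosh _)
      h1).const_mul B).ofReal_comp
    have h3 : HasDerivAt (fun t : ℝ => Complex.exp (Complex.I * (N * x + (φ * t : ℝ))))
        (Complex.exp (Complex.I * (N * x + (φ * t : ℝ))) * (Complex.I * (φ * 1 : ℝ))) t :=
      (((((hasDerivAt_id t).const_mul φ).ofReal_comp).const_add (N * x : ℂ)).const_mul
        Complex.I).cexp
    rw [funext fun τ => hx τ x]
    refine (h3.fun_mul h2).congr_deriv ?_
    rw [hx]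
    simp only [Function.comp]
    push_cast
    ring
  refine ⟨?_, fun t _ x => (hderiv t x).differentiableAt, fun t _ x => ?_⟩
  · exact ((wavePacket N A hA).continuous.comp
      (continuous_solitonShape h φ (A * p))).continuousOn
  · have hprof := isSolitonProfile_sech N B (φ * t) (p * t) (hx t)
    have hI : Complex.I ^ (2 * j) = (-1) ^ j := by rw [pow_mul, Complex.I_sq]
    have hs : (-1 : ℂ) ^ j * (-1) ^ j = 1 := by rw [← mul_pow]; simp
    rw [hc, (hderiv t x).deriv, (hprof.evalAt_flow (2 * j) x).1, hI, ← hp, ← hm,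
      pow_succ (-1 : ℂ) j]
    have hφ' : (φ : ℂ) = -(N * p + m) := by rw [hφ]; push_cast; ring
    rw [hφ']
    generalize ((-(B ^ 2 * ((Real.cosh (B * (x - p * t)))⁻¹ *
      Real.tanh (B * (x - p * t)))) : ℝ) : ℂ) = Q
    generalize soliton N A hA h φ p t x = w
    linear_combination (-m * w) * Complex.I_sq
      - (-Complex.I * p * (Complex.I * N * w + Complex.exp (Complex.I * (N * x + (φ * t : ℝ))) * Q)
        + m * w) * hs

end

section

open MeasureTheory
open scoped FourierTransform

/-! ### Modulation norms of Schwartz functions -/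

lemma enorm_toLp_two (f : 𝓢(ℝ, ℂ)) : ‖f.toLp 2‖ₑ = eLpNorm f 2 volume :=
  Lp.enorm_toLp _

lemma exists_lp_eq_toDistribution (f : 𝓢(ℝ, ℂ)) :
    ∃ g : Lp ℂ 2 (volume : Measure ℝ), Lp.toTemperedDistribution g = toDistribution f ∧
      ‖g‖ₑ = eLpNorm f 2 volume := by
  refine ⟨MemLp.toLp f (f.memLp 2 volume), ?_, Lp.enorm_toLp _⟩
  exact Lp.toTemperedDistribution_toLp_eq f

/-- The norm is finite on Schwartz functions and given by the function itself, since an `L²`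
function is determined by its distribution. -/
lemma lTwoNorm_toDistribution (f : 𝓢(ℝ, ℂ)) : lTwoNorm (toDistribution f) = eLpNorm f 2 volume := by
  obtain ⟨g, hg, hgn⟩ := exists_lp_eq_toDistribution f
  have hker := Lp.ker_toTemperedDistributionCLM_eq_bot (F := ℂ) (μ := (volume : Measure ℝ)) (p := 2)
  rw [← hgn]
  refine le_antisymm (iInf₂_le g hg) (le_iInf₂ fun g' hg' => ?_)
  have hgf : g' - g ∈ (Lp.toTemperedDistributionCLM ℂ (volume : Measure ℝ) 2).ker := by
    rw [LinearMap.mem_ker, ContinuousLinearMap.coe_coe, map_sub,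
      Lp.toTemperedDistributionCLM_apply, Lp.toTemperedDistributionCLM_apply, hg', hg, sub_self]
  rw [hker, Submodule.mem_bot, sub_eq_zero] at hgf
  rw [hgf]

lemma eLpNorm_fourier (f : 𝓢(ℝ, ℂ)) :
    eLpNorm (𝓕 f : 𝓢(ℝ, ℂ)) 2 volume = eLpNorm f 2 volume := by
  rw [← enorm_toLp_two, ← enorm_toLp_two, ← ofReal_norm, ← ofReal_norm,
    SchwartzMap.norm_fourier_toL2_eq]

lemma IsFrequencyCutoff.hasCompactSupport {ψ : ℝ → ℝ} (hψ : IsFrequencyCutoff ψ) :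
    HasCompactSupport ψ :=
  isCompact_Icc.of_isClosed_subset (isClosed_tsupport ψ) hψ.support

lemma IsFrequencyCutoff.eq_zero {ψ : ℝ → ℝ} (hψ : IsFrequencyCutoff ψ) {ξ : ℝ}
    (hξ : ξ ∉ Set.Icc (-(1 / 4) : ℝ) (5 / 4)) : ψ ξ = 0 :=
  image_eq_zero_of_notMem_tsupport fun h => hξ (hψ.support h)

lemma IsFrequencyCutoff.exists_bound {ψ : ℝ → ℝ} (hψ : IsFrequencyCutoff ψ) :
    ∃ C : ℝ, 0 < C ∧ ∀ ξ, |ψ ξ| ≤ C := by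
  obtain ⟨C, hC⟩ := hψ.hasCompactSupport.exists_bound_of_continuous hψ.smooth.continuous
  exact ⟨|C| + 1, by positivity, fun ξ => (hC ξ).trans (by linarith [le_abs_self C])⟩

lemma IsFrequencyCutoff.hasTemperateGrowth {ψ : ℝ → ℝ} (hψ : IsFrequencyCutoff ψ) (a : ℝ) :
    Function.HasTemperateGrowth fun η : ℝ => ((ψ (-(2 * Real.pi * η) - a) : ℝ) : ℂ) := by
  have h1 : ψ.HasTemperateGrowth := hψ.hasCompactSupport.hasTemperateGrowth hψ.smooth
  have h2 : Function.HasTemperateGrowth fun η : ℝ => -(2 * Real.pi * η) - a := by fun_prop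
  exact Function.HasTemperateGrowth.comp
    (Function.Complex.hasTemperateGrowth_ofReal) (h1.comp h2)

lemma lTwoNorm_box {ψ : ℝ → ℝ} (hψ : IsFrequencyCutoff ψ) (m : ℤ) (f : 𝓢(ℝ, ℂ)) :
    lTwoNorm (box ψ m (toDistribution f))
      = eLpNorm (fun η => ((ψ (-(2 * Real.pi * η) - m) : ℝ) : ℂ) * 𝓕 f η) 2 volume := by
  have hg := hψ.hasTemperateGrowth m
  have h : box ψ m (toDistribution f) = toDistribution (SchwartzMap.fourierMultiplierCLM ℂ
      (fun η : ℝ => ((ψ (-(2 * Real.pi * η) - m) : ℝ) : ℂ)) f) :=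
    TemperedDistribution.fourierMultiplierCLM_toTemperedDistributionCLM_eq hg f
  rw [h, lTwoNorm_toDistribution, ← eLpNorm_fourier, SchwartzMap.fourierMultiplierCLM_apply,
    FourierTransform.fourier_fourierInv_eq, SchwartzMap.smulLeftCLM_apply hg]
  rfl

/-! ### Wave packets on the Fourier side -/

lemma fourier_wavePacket (N : ℝ) {A : ℝ} (hA : 0 < A) (r : 𝓢(ℝ, ℂ)) (η : ℝ) :
    𝓕 (wavePacket N A hA.ne' r) η = 𝓕 r (A⁻¹ * (η - N / (2 * Real.pi))) := by
  rw [SchwartzMap.fourier_coe, SchwartzMap.fourier_coe, Real.fourier_eq', Real.fourier_eq']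
  have h := Measure.integral_comp_mul_left (fun y : ℝ =>
    Complex.exp (((-2 * Real.pi * inner ℝ y (A⁻¹ * (η - N / (2 * Real.pi))) : ℝ) : ℂ) * Complex.I)
      • r y) A
  rw [abs_of_pos (inv_pos.2 hA), eq_inv_smul_iff₀ hA.ne'] at h
  rw [← h, ← integral_smul]
  refine integral_congr_ae (Filter.Eventually.of_forall fun x => ?_)
  simp only [wavePacket_apply, smul_eq_mul, Complex.real_smul, RCLike.inner_apply, conj_trivial]
  rw [← mul_assoc, ← Complex.exp_add, mul_left_comm]
  congr 3
  have hA' : (A : ℂ) ≠ 0 := by exact_mod_cast hA.ne'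
  have hpi : (Real.pi : ℂ) ≠ 0 := by exact_mod_cast Real.pi_ne_zero
  push_cast
  field_simp
  ring

lemma eLpNorm_comp_affine {g : ℝ → ℂ} (hg : Continuous g) {A : ℝ} (hA : 0 < A) (c : ℝ) :
    eLpNorm (fun η => g (A⁻¹ * (η - c))) 2 volume
      = ENNReal.ofReal A ^ (1 / 2 : ℝ) * eLpNorm g 2 volume := by
  have h1 : Measure.map (fun η : ℝ => A⁻¹ * (η - c)) volume = ENNReal.ofReal A • volume := by
    rw [show (fun η : ℝ => A⁻¹ * (η - c)) = (A⁻¹ * ·) ∘ (· - c) from rfl,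
      ← Measure.map_map (by fun_prop) (by fun_prop), map_sub_right_eq_self,
      Real.map_volume_mul_left (inv_ne_zero hA.ne'), inv_inv, abs_of_pos hA]
  have h2 := eLpNorm_map_measure (p := 2) (f := fun η : ℝ => A⁻¹ * (η - c)) (μ := volume)
    (g := g) hg.aestronglyMeasurable (by fun_prop)
  rw [h1, eLpNorm_smul_measure_of_ne_top (by simp)] at h2
  simpa [Function.comp_def] using h2.symm

/-- In the variable of the shape `r`, the frequency interval number `m` is seen by a wave packet
centred in the middle of the interval number `n` through a cut-off of width `A⁻¹`. The factor
`e^{-i(n+1/2)x}` has frequency `n + 1/2` because the Fourier transform has the kernel `e^{ixξ}`. -/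
lemma lTwoNorm_box_wavePacket {ψ : ℝ → ℝ} (hψ : IsFrequencyCutoff ψ) (n m : ℤ) {A : ℝ}
    (hA : 0 < A) (r : 𝓢(ℝ, ℂ)) :
    lTwoNorm (box ψ m (toDistribution (wavePacket (-(n + 1 / 2)) A hA.ne' r)))
      = ENNReal.ofReal A ^ (1 / 2 : ℝ) *
        eLpNorm (fun η => ((ψ (n + 1 / 2 - m - 2 * Real.pi * A * η) : ℝ) : ℂ) * 𝓕 r η) 2
          volume := by
  have hcont : Continuous fun η : ℝ =>
      ((ψ (n + 1 / 2 - m - 2 * Real.pi * A * η) : ℝ) : ℂ) * 𝓕 r η := by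
    have := hψ.smooth.continuous
    have := (𝓕 r).continuous
    fun_prop
  rw [lTwoNorm_box hψ, ← eLpNorm_comp_affine hcont hA (-(n + 1 / 2) / (2 * Real.pi))]
  congr 1
  funext η
  rw [fourier_wavePacket _ hA]
  congr 3
  field_simp
  ring

/-- The multiplier `(1 - ∂ₓ²)ᵏ` as a map from the Schwartz functions to `L²`, on the Fourier side;
the norm of the image is the `H²ᵏ` norm. -/
def sobolevMap (k : ℕ) : 𝓢(ℝ, ℂ) →L[ℂ] Lp ℂ 2 (volume : Measure ℝ) :=
  SchwartzMap.toLpCLM ℂ ℂ 2 volume ∘L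
    SchwartzMap.smulLeftCLM ℂ (fun η : ℝ => (1 + (2 * Real.pi * (η : ℂ)) ^ 2) ^ k) ∘L
    FourierTransform.fourierCLM ℂ 𝓢(ℝ, ℂ)

lemma enorm_sobolevMap (k : ℕ) (r : 𝓢(ℝ, ℂ)) : ‖sobolevMap k r‖ₑ
    = eLpNorm (fun η : ℝ => (1 + (2 * Real.pi * (η : ℂ)) ^ 2) ^ k * 𝓕 r η) 2 volume := by
  have hg : Function.HasTemperateGrowth fun η : ℝ => (1 + (2 * Real.pi * (η : ℂ)) ^ 2) ^ k := by
    fun_prop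
  change ‖(SchwartzMap.smulLeftCLM ℂ (fun η : ℝ => (1 + (2 * Real.pi * (η : ℂ)) ^ 2) ^ k)
    (𝓕 r)).toLp 2 volume‖ₑ = _
  rw [enorm_toLp_two, SchwartzMap.smulLeftCLM_apply hg]
  rfl

lemma norm_sobolevWeight (k : ℕ) (η : ℝ) :
    ‖(1 + (2 * Real.pi * (η : ℂ)) ^ 2) ^ k‖ = (1 + (2 * Real.pi * η) ^ 2) ^ k := by
  rw [show (1 + (2 * Real.pi * (η : ℂ)) ^ 2) ^ k = (((1 + (2 * Real.pi * η) ^ 2) ^ k : ℝ) : ℂ) by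
    push_cast; ring, Complex.norm_real, Real.norm_of_nonneg (by positivity)]

/-- A multiplier that is dominated by the weight of `sobolevMap` is bounded by its norm. -/
lemma eLpNorm_mul_fourier_le {k : ℕ} {a : ℝ → ℝ} {C : ℝ}
    (ha : ∀ η, |a η| ≤ C * (1 + (2 * Real.pi * η) ^ 2) ^ k) (r : 𝓢(ℝ, ℂ)) :
    eLpNorm (fun η => (a η : ℂ) * 𝓕 r η) 2 volume ≤ ENNReal.ofReal C * ‖sobolevMap k r‖ₑ := by
  rw [enorm_sobolevMap]
  refine eLpNorm_le_mul_eLpNorm_of_ae_le_mul (Filter.Eventually.of_forall fun η => ?_) 2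
  rw [norm_mul, norm_mul, norm_sobolevWeight, Complex.norm_real, Real.norm_eq_abs, ← mul_assoc]
  gcongr
  exact ha η

lemma enorm_sobolevMap_translate (k : ℕ) (b : ℝ) (r : 𝓢(ℝ, ℂ)) :
    ‖sobolevMap k (translate b r)‖ₑ = ‖sobolevMap k r‖ₑ := by
  rw [enorm_sobolevMap, enorm_sobolevMap]
  refine eLpNorm_congr_norm_ae (Filter.Eventually.of_forall fun η => ?_)
  rw [norm_mul, norm_mul]
  congr 1
  have h : 𝓕 (translate b r) η
      = Complex.exp (((-2 * Real.pi * (b * η) : ℝ) : ℂ) * Complex.I) * 𝓕 r η := by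
    rw [SchwartzMap.fourier_coe, SchwartzMap.fourier_coe, Real.fourier_eq', Real.fourier_eq',
      ← integral_const_mul, ← integral_sub_right_eq_self (fun x =>
        Complex.exp (((-2 * Real.pi * (b * η) : ℝ) : ℂ) * Complex.I) * _) b]
    refine integral_congr_ae (Filter.Eventually.of_forall fun x => ?_)
    simp only [translate_apply, smul_eq_mul, RCLike.inner_apply, conj_trivial]
    rw [← mul_assoc (Complex.exp _) (Complex.exp _), ← Complex.exp_add]
    congr 2
    push_cast
    ring
  rw [h, norm_mul, Complex.norm_exp_ofReal_mul_I, one_mul]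

/-! ### Upper and lower bounds for wave packets -/

/-- The `ℓᵖ` norm is at most the `ℓ¹` norm. -/
lemma eLpNorm_count_le_tsum (a : ℤ → ℝ≥0∞) {p : ℝ≥0∞} (hp : 1 ≤ p) :
    eLpNorm a p Measure.count ≤ ∑' n, a n := by
  by_cases htop : p = ⊤
  · subst htop
    rw [eLpNorm_exponent_top, eLpNormEssSup_count]
    exact iSup_le fun n => ENNReal.le_tsum n
  have hp0 : p ≠ 0 := (zero_lt_one.trans_le hp).ne'
  have hp1 : 1 ≤ p.toReal := by
    simpa using (ENNReal.toReal_le_toReal (by simp) htop).2 hp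
  rw [eLpNorm_eq_lintegral_rpow_enorm_toReal hp0 htop, lintegral_count, one_div,
    ENNReal.rpow_inv_le_iff (by linarith)]
  have hsplit : ∀ x : ℝ≥0∞, x ^ p.toReal = x * x ^ (p.toReal - 1) := fun x => by
    nth_rw 2 [← ENNReal.rpow_one x]
    rw [← ENNReal.rpow_add_of_nonneg _ _ zero_le_one (by linarith)]
    congr 1
    ring
  simp only [enorm_eq_self]
  rw [hsplit (∑' n, a n), ← ENNReal.tsum_mul_right]
  refine ENNReal.tsum_le_tsum fun n => ?_
  rw [hsplit]
  gcongr
  exact ENNReal.le_tsum n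

lemma tsum_ofReal_inv_one_add_sq_sub (n : ℤ) :
    ∑' m : ℤ, ENNReal.ofReal (1 + ((m - n : ℤ) : ℝ) ^ 2)⁻¹
      = ∑' d : ℤ, ENNReal.ofReal (1 + (d : ℝ) ^ 2)⁻¹ :=
  (Equiv.subRight n).tsum_eq fun d : ℤ => ENNReal.ofReal (1 + (d : ℝ) ^ 2)⁻¹

lemma tsum_ofReal_inv_one_add_sq_ne_top :
    ∑' d : ℤ, ENNReal.ofReal (1 + (d : ℝ) ^ 2)⁻¹ ≠ ⊤ := by
  have h : Summable fun d : ℤ => (1 + (d : ℝ) ^ 2)⁻¹ := by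
    have h1 := (Real.summable_one_div_int_pow (p := 2)).2 one_lt_two
    refine h1.of_norm_bounded_eventually ?_
    filter_upwards [(Set.finite_singleton (0 : ℤ)).compl_mem_cofinite] with d hd
    have hd0 : (d : ℝ) ≠ 0 := by
      simpa using hd
    have : 0 < (d : ℝ) ^ 2 := by positivity
    rw [Real.norm_of_nonneg (by positivity), one_div]
    gcongr
    linarith
  exact h.tsum_ofReal_ne_top

/-- The smoothness that suffices to sum the blocks in `M^s_{2,p}`. -/
def smoothnessIndex (s : ℝ) : ℕ := ⌈s⌉₊ + 1

lemma japanese_rpow_le {s : ℝ} (hs : 0 ≤ s) (n m : ℤ) :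
    √(1 + (m : ℝ) ^ 2) ^ s ≤ √2 ^ s * √(1 + (n : ℝ) ^ 2) ^ s *
      (1 + ((m - n : ℤ) : ℝ) ^ 2) ^ ⌈s⌉₊ := by
  have h1 : √(1 + (m : ℝ) ^ 2) ≤ √2 * √(1 + (n : ℝ) ^ 2) * √(1 + ((m - n : ℤ) : ℝ) ^ 2) := by
    rw [← Real.sqrt_mul (by norm_num), ← Real.sqrt_mul (by positivity)]
    refine Real.sqrt_le_sqrt ?_
    push_cast
    nlinarith [sq_nonneg ((n : ℝ) * (m - n)), sq_nonneg ((n : ℝ) - (m - n))]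
  have h2 : √(1 + ((m - n : ℤ) : ℝ) ^ 2) ^ s ≤ (1 + ((m - n : ℤ) : ℝ) ^ 2) ^ ⌈s⌉₊ := by
    have h3 : 1 ≤ √(1 + ((m - n : ℤ) : ℝ) ^ 2) :=
      Real.one_le_sqrt.2 (le_add_of_nonneg_right (sq_nonneg _))
    calc √(1 + ((m - n : ℤ) : ℝ) ^ 2) ^ s
        ≤ √(1 + ((m - n : ℤ) : ℝ) ^ 2) ^ (⌈s⌉₊ : ℝ) :=
          Real.rpow_le_rpow_of_exponent_le h3 (Nat.le_ceil s)
      _ = √(1 + ((m - n : ℤ) : ℝ) ^ 2) ^ ⌈s⌉₊ := Real.rpow_natCast _ _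
      _ ≤ (1 + ((m - n : ℤ) : ℝ) ^ 2) ^ ⌈s⌉₊ := by
          gcongr
          refine Real.sqrt_le_iff.2 ⟨by positivity, ?_⟩
          nlinarith [sq_nonneg ((m - n : ℤ) : ℝ)]
  calc √(1 + (m : ℝ) ^ 2) ^ s
      ≤ (√2 * √(1 + (n : ℝ) ^ 2) * √(1 + ((m - n : ℤ) : ℝ) ^ 2)) ^ s := by gcongr
    _ = √2 ^ s * √(1 + (n : ℝ) ^ 2) ^ s * √(1 + ((m - n : ℤ) : ℝ) ^ 2) ^ s := by
        rw [Real.mul_rpow (by positivity) (by positivity),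
          Real.mul_rpow (by positivity) (by positivity)]
    _ ≤ _ := by gcongr

/-- On the support of the cut-off number `m` the frequency has at least the distance `|m - n| - 3/4`
from the centre of the wave packet, so the decay of `𝓕 r` can be traded for decay in `m - n`. -/
lemma abs_cutoff_le {ψ : ℝ → ℝ} (hψ : IsFrequencyCutoff ψ) {C : ℝ} (hC : ∀ ξ, |ψ ξ| ≤ C)
    (n m : ℤ) {A : ℝ} (hA : 0 < A) (hA1 : A ≤ 1) (k : ℕ) (η : ℝ) :
    |ψ (n + 1 / 2 - m - 2 * Real.pi * A * η)|
      ≤ C * 3 ^ k * ((1 + ((m - n : ℤ) : ℝ) ^ 2) ^ k)⁻¹ * (1 + (2 * Real.pi * η) ^ 2) ^ k := by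
  have hC0 : 0 ≤ C := (abs_nonneg _).trans (hC 0)
  by_cases h : (n + 1 / 2 - m - 2 * Real.pi * A * η) ∈ Set.Icc (-(1 / 4) : ℝ) (5 / 4)
  · have hsq : (2 * Real.pi * A * η) ^ 2 ≤ (2 * Real.pi * η) ^ 2 := by
      rw [show 2 * Real.pi * A * η = A * (2 * Real.pi * η) by ring, mul_pow]
      exact mul_le_of_le_one_left (sq_nonneg _) (pow_le_one₀ hA.le hA1)
    have hdist : 1 + ((m - n : ℤ) : ℝ) ^ 2 ≤ 3 * (1 + (2 * Real.pi * η) ^ 2) := by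
      push_cast
      obtain ⟨h1, h2⟩ := h
      set y := 2 * Real.pi * A * η
      have h3 : ((m : ℝ) - n + y) ^ 2 ≤ (3 / 4) ^ 2 := by
        rw [sq_le_sq, abs_le]
        constructor <;> rw [abs_of_pos (by norm_num : (0 : ℝ) < 3 / 4)] <;> linarith
      nlinarith [sq_nonneg ((m : ℝ) - n + 2 * y)]
    have hpow : (1 + ((m - n : ℤ) : ℝ) ^ 2) ^ k ≤ 3 ^ k * (1 + (2 * Real.pi * η) ^ 2) ^ k := by
      rw [← mul_pow]
      gcongr
    refine (hC _).trans ?_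
    have hd : 0 < (1 + ((m - n : ℤ) : ℝ) ^ 2) ^ k := by positivity
    calc C = C * ((1 + ((m - n : ℤ) : ℝ) ^ 2) ^ k * ((1 + ((m - n : ℤ) : ℝ) ^ 2) ^ k)⁻¹) := by
          rw [mul_inv_cancel₀ hd.ne', mul_one]
      _ ≤ C * (3 ^ k * (1 + (2 * Real.pi * η) ^ 2) ^ k * ((1 + ((m - n : ℤ) : ℝ) ^ 2) ^ k)⁻¹) := by
          gcongr
      _ = _ := by ring
  · rw [hψ.eq_zero h, abs_zero]
    positivity

/-- The `M^s_{2,p}` norm of a wave packet of frequency `n` is at most `⟨n⟩ˢ A^{1/2}` times a Sobolev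
norm of its shape. -/
lemma exists_modNorm_wavePacket_le {ψ : ℝ → ℝ} (hψ : IsFrequencyCutoff ψ) {s : ℝ} (hs : 0 ≤ s)
    {p : ℝ≥0∞} (hp : 1 ≤ p) :
    ∃ K : ℝ≥0, ∀ (n : ℤ) (A : ℝ) (hA : 0 < A), A ≤ 1 → ∀ r : 𝓢(ℝ, ℂ),
      modNorm ψ s p (toDistribution (wavePacket (-(n + 1 / 2)) A hA.ne' r))
        ≤ K * (ENNReal.ofReal (√(1 + (n : ℝ) ^ 2) ^ s) * ENNReal.ofReal A ^ (1 / 2 : ℝ)) *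
          ‖sobolevMap (smoothnessIndex s) r‖ₑ := by
  obtain ⟨C, hC0, hC⟩ := hψ.exists_bound
  set S := ∑' d : ℤ, ENNReal.ofReal (1 + (d : ℝ) ^ 2)⁻¹ with hS
  have hStop : S ≠ ⊤ := tsum_ofReal_inv_one_add_sq_ne_top
  refine ⟨(ENNReal.ofReal (√2 ^ s * (C * 3 ^ smoothnessIndex s)) * S).toNNReal,
    fun n A hA hA1 r => ?_⟩
  rw [ENNReal.coe_toNNReal (ENNReal.mul_ne_top ENNReal.ofReal_ne_top hStop)]
  refine (eLpNorm_count_le_tsum _ hp).trans ?_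
  have hterm : ∀ m : ℤ, ENNReal.ofReal (√(1 + (m : ℝ) ^ 2) ^ s) *
      lTwoNorm (box ψ m (toDistribution (wavePacket (-(n + 1 / 2)) A hA.ne' r)))
      ≤ ENNReal.ofReal (√2 ^ s * (C * 3 ^ smoothnessIndex s)) *
        (ENNReal.ofReal (√(1 + (n : ℝ) ^ 2) ^ s) * ENNReal.ofReal A ^ (1 / 2 : ℝ)) *
          ‖sobolevMap (smoothnessIndex s) r‖ₑ *
        ENNReal.ofReal (1 + ((m - n : ℤ) : ℝ) ^ 2)⁻¹ := by
    intro m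
    rw [lTwoNorm_box_wavePacket hψ n m hA r]
    have h1 := eLpNorm_mul_fourier_le (abs_cutoff_le hψ hC n m hA hA1 (smoothnessIndex s)) r
    have hd : (1 + ((m - n : ℤ) : ℝ) ^ 2) ≠ 0 := by positivity
    calc _ ≤ ENNReal.ofReal (√2 ^ s * √(1 + (n : ℝ) ^ 2) ^ s *
            (1 + ((m - n : ℤ) : ℝ) ^ 2) ^ ⌈s⌉₊) * (ENNReal.ofReal A ^ (1 / 2 : ℝ) *
            (ENNReal.ofReal (C * 3 ^ smoothnessIndex s *
              ((1 + ((m - n : ℤ) : ℝ) ^ 2) ^ smoothnessIndex s)⁻¹) *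
              ‖sobolevMap (smoothnessIndex s) r‖ₑ)) := by
          gcongr
          exact japanese_rpow_le hs n m
      _ = ENNReal.ofReal (√2 ^ s * √(1 + (n : ℝ) ^ 2) ^ s *
            (1 + ((m - n : ℤ) : ℝ) ^ 2) ^ ⌈s⌉₊ * (C * 3 ^ smoothnessIndex s *
              ((1 + ((m - n : ℤ) : ℝ) ^ 2) ^ smoothnessIndex s)⁻¹)) *
            (ENNReal.ofReal A ^ (1 / 2 : ℝ) * ‖sobolevMap (smoothnessIndex s) r‖ₑ) := by
          rw [ENNReal.ofReal_mul (p := √2 ^ s * √(1 + (n : ℝ) ^ 2) ^ s *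
            (1 + ((m - n : ℤ) : ℝ) ^ 2) ^ ⌈s⌉₊) (by positivity)]
          ring
      _ = ENNReal.ofReal (√2 ^ s * (C * 3 ^ smoothnessIndex s) * √(1 + (n : ℝ) ^ 2) ^ s *
            (1 + ((m - n : ℤ) : ℝ) ^ 2)⁻¹) *
            (ENNReal.ofReal A ^ (1 / 2 : ℝ) * ‖sobolevMap (smoothnessIndex s) r‖ₑ) := by
          congr 2
          rw [smoothnessIndex, pow_succ (1 + ((m - n : ℤ) : ℝ) ^ 2)]
          field_simp
      _ = _ := by
          rw [ENNReal.ofReal_mul (by positivity), ENNReal.ofReal_mul (by positivity)]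
          ring
  refine (ENNReal.tsum_le_tsum hterm).trans ?_
  rw [ENNReal.tsum_mul_left, tsum_ofReal_inv_one_add_sq_sub, ← hS]
  exact le_of_eq (by ring)

/-- If the wave packet is wide, then most of it lies in the frequency interval number `n`. -/
lemma exists_le_modNorm_wavePacket {ψ : ℝ → ℝ} (hψ : IsFrequencyCutoff ψ) (s : ℝ)
    {p : ℝ≥0∞} (hp : 1 ≤ p) :
    ∃ C : ℝ, 0 < C ∧ ∀ (n : ℤ) (A : ℝ) (hA : 0 < A) (r : 𝓢(ℝ, ℂ)),
      ENNReal.ofReal (√(1 + (n : ℝ) ^ 2) ^ s) * ENNReal.ofReal A ^ (1 / 2 : ℝ) *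
          (eLpNorm r 2 volume - ENNReal.ofReal (C * A) * ‖sobolevMap (smoothnessIndex s) r‖ₑ)
        ≤ modNorm ψ s p (toDistribution (wavePacket (-(n + 1 / 2)) A hA.ne' r)) := by
  obtain ⟨C, hC0, hC⟩ := hψ.exists_bound
  refine ⟨2 * (1 + C), by positivity, fun n A hA r => ?_⟩
  refine le_trans ?_ (enorm_le_eLpNorm_count _ n (zero_lt_one.trans_le hp).ne')
  rw [enorm_eq_self, lTwoNorm_box_wavePacket hψ n n hA r, ← mul_assoc]
  gcongr
  rw [tsub_le_iff_right, ← eLpNorm_fourier]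
  have hψc := hψ.smooth.continuous
  have hrc := (𝓕 r).continuous
  have hsplit : ⇑(𝓕 r : 𝓢(ℝ, ℂ)) = (fun η : ℝ =>
      ((ψ (n + 1 / 2 - n - 2 * Real.pi * A * η) : ℝ) : ℂ) * 𝓕 r η) + fun η : ℝ =>
      ((1 - ψ (n + 1 / 2 - n - 2 * Real.pi * A * η) : ℝ) : ℂ) * 𝓕 r η := by
    funext η
    simp only [Pi.add_apply]
    push_cast
    ring
  conv_lhs => rw [hsplit]
  refine (eLpNorm_add_le (by fun_prop) (by fun_prop) one_le_two).trans ?_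
  gcongr
  refine eLpNorm_mul_fourier_le (fun η => ?_) r
  by_cases h : |2 * Real.pi * A * η| ≤ 1 / 2
  · rw [abs_le] at h
    rw [hψ.eq_one _ ⟨by linarith, by linarith⟩, sub_self, abs_zero]
    positivity
  · push Not at h
    have h1 : |1 - ψ (n + 1 / 2 - n - 2 * Real.pi * A * η)| ≤ 1 + C :=
      (abs_sub _ _).trans (by simpa using hC _)
    have h2 : (1 : ℝ) ≤ 2 * A * |2 * Real.pi * η| := by
      rw [show 2 * Real.pi * A * η = A * (2 * Real.pi * η) by ring, abs_mul, abs_of_pos hA] at h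
      linarith
    have h3 : |2 * Real.pi * η| ≤ 1 + (2 * Real.pi * η) ^ 2 := by
      nlinarith [sq_abs (2 * Real.pi * η), sq_nonneg (|2 * Real.pi * η| - 1)]
    have h4 : 1 + (2 * Real.pi * η) ^ 2 ≤ (1 + (2 * Real.pi * η) ^ 2) ^ smoothnessIndex s :=
      le_self_pow₀ (le_add_of_nonneg_right (sq_nonneg _)) (Nat.succ_ne_zero _)
    calc _ ≤ (1 + C) * 1 := by rwa [mul_one]
      _ ≤ (1 + C) * (2 * A * (1 + (2 * Real.pi * η) ^ 2) ^ smoothnessIndex s) := by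
          gcongr
          exact h2.trans (by gcongr; exact h3.trans h4)
      _ = _ := by ring

end

section

open MeasureTheory Filter
open scoped Topology

/-! ### Decoherence of the phases -/

/-- The second-order expansion of `(1 + w)ᵐ`. -/
lemma exists_norm_one_add_pow_sub_le (m : ℕ) : ∃ C : ℝ, 0 ≤ C ∧ ∀ w : ℂ, ‖w‖ ≤ 1 →
    ‖(1 + w) ^ m - (1 + m * w + m * (m - 1) / 2 * w ^ 2)‖ ≤ C * ‖w‖ ^ 3 := by
  induction m with
  | zero => exact ⟨0, le_rfl, fun w _ => by simp⟩
  | succ m ih =>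
    obtain ⟨C, hC0, hC⟩ := ih
    refine ⟨C * 2 + ‖(m * (m - 1) / 2 : ℂ)‖, by positivity, fun w hw => ?_⟩
    have h1 : (1 + w) ^ (m + 1) - (1 + (m + 1 : ℕ) * w
          + (m + 1 : ℕ) * ((m + 1 : ℕ) - 1) / 2 * w ^ 2)
        = ((1 + w) ^ m - (1 + m * w + m * (m - 1) / 2 * w ^ 2)) * (1 + w)
          + m * (m - 1) / 2 * w ^ 3 := by
      push_cast
      ring
    rw [h1, add_mul]
    refine (norm_add_le _ _).trans (add_le_add ?_ (by rw [norm_mul, norm_pow]))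
    have h2 : ‖1 + w‖ ≤ 2 := (norm_add_le _ _).trans (by rw [norm_one]; linarith)
    rw [norm_mul]
    calc _ ≤ C * ‖w‖ ^ 3 * 2 := mul_le_mul (hC w hw) h2 (norm_nonneg _) (by positivity)
      _ = _ := by ring

lemma exists_abs_re_one_sub_pow_le (m : ℕ) : ∃ C : ℝ, 0 ≤ C ∧ ∀ y : ℝ, 0 ≤ y → y ≤ 1 →
    |((1 - (y : ℂ) * Complex.I) ^ m).re - (1 - m * (m - 1) / 2 * y ^ 2)| ≤ C * y ^ 3 := by
  obtain ⟨C, hC0, hC⟩ := exists_norm_one_add_pow_sub_le m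
  refine ⟨C, hC0, fun y hy0 hy1 => ?_⟩
  have hn : ‖(-(y * Complex.I) : ℂ)‖ = y := by
    rw [norm_neg, norm_mul, Complex.norm_I, mul_one, Complex.norm_real, Real.norm_of_nonneg hy0]
  have h := (Complex.abs_re_le_norm _).trans (hC (-(y * Complex.I)) (by rwa [hn]))
  rw [hn] at h
  have h2 : (m * (m - 1) / 2 * (-(y * Complex.I)) ^ 2 : ℂ)
      = ((-(m * (m - 1) / 2 * y ^ 2) : ℝ) : ℂ) := by
    push_cast
    linear_combination (m * (m - 1) / 2 * y ^ 2 : ℂ) * Complex.I_sq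
  have h3 : (1 + (m : ℂ) * -(y * Complex.I) + ((-(m * (m - 1) / 2 * y ^ 2) : ℝ) : ℂ)).re
      = 1 - m * (m - 1) / 2 * y ^ 2 := by
    rw [Complex.add_re, Complex.ofReal_re]
    simp
    ring
  rwa [h2, Complex.sub_re, h3, ← sub_eq_add_neg] at h

/-- The amplitude `a ⟨n⟩^{-2s}` for which a wave packet of frequency `n` has size `a^{1/2}`
in `M^s_{2,p}`. -/
def amplitude (a s : ℝ) (n : ℤ) : ℝ := a * √(1 + (n : ℝ) ^ 2) ^ (-(2 * s))

lemma one_le_bracket (n : ℤ) : 1 ≤ √(1 + (n : ℝ) ^ 2) :=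
  Real.one_le_sqrt.2 (le_add_of_nonneg_right (sq_nonneg _))

lemma amplitude_pos {a : ℝ} (ha : 0 < a) (s : ℝ) (n : ℤ) : 0 < amplitude a s n := by
  unfold amplitude
  have := one_le_bracket n
  positivity

lemma amplitude_le {a s : ℝ} (ha : 0 < a) (hs : 0 ≤ s) (n : ℤ) : amplitude a s n ≤ a :=
  mul_le_of_le_one_right ha.le
    (Real.rpow_le_one_of_one_le_of_nonpos (one_le_bracket n) (by linarith))

lemma ofReal_bracket_mul_amplitude {a : ℝ} (ha : 0 < a) (s : ℝ) (n : ℤ) :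
    ENNReal.ofReal (√(1 + (n : ℝ) ^ 2) ^ s) * ENNReal.ofReal (amplitude a s n) ^ (1 / 2 : ℝ)
      = ENNReal.ofReal (√a) := by
  have hb := zero_lt_one.trans_le (one_le_bracket n)
  rw [ENNReal.ofReal_rpow_of_nonneg (amplitude_pos ha s n).le (by norm_num),
    ← ENNReal.ofReal_mul (by positivity), amplitude,
    Real.mul_rpow ha.le (by positivity), ← Real.rpow_mul hb.le, mul_left_comm,
    ← Real.rpow_add hb, ← Real.sqrt_eq_rpow, show s + -(2 * s) * (1 / 2) = 0 by ring,
    Real.rpow_zero, mul_one]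

/-- The frequency with which the phase of the soliton rotates. -/
def phaseSpeed (j : ℕ) (N B : ℝ) : ℝ := -(((N : ℂ) + (B : ℝ) * Complex.I) ^ (2 * j)).re

/-- Two solitons of the same frequency `n` whose amplitudes have the ratio `e^h` differ in phase
speed by about `h n^{2j-2} A² ∼ h n^{2j-2-4s}`. This is unbounded exactly for `s < (j-1)/2`, so
however small `h` is allowed to be, the solitons can be made to have opposite phases at time `t`. -/
lemma exists_opposite_phases {j : ℕ} (hj : 2 ≤ j) {s : ℝ} (hs₀ : 0 ≤ s)
    (hs : s < ((j : ℝ) - 1) / 2) {a : ℝ} (ha : 0 < a) {t : ℝ} (ht : t ≠ 0) {η : ℝ} (hη : 0 < η) :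
    ∃ (n : ℤ), ∃ h ∈ Set.Icc 0 η,
      Complex.exp (Complex.I * ((phaseSpeed j (-(n + 1 / 2)) (amplitude a s n * Real.exp h) * t :
        ℝ) : ℂ)) = -Complex.exp (Complex.I * ((phaseSpeed j (-(n + 1 / 2))
          (amplitude a s n * Real.exp 0) * t : ℝ) : ℂ)) := by
  obtain ⟨C, hC0, hC⟩ := exists_abs_re_one_sub_pow_le (2 * j)
  have hj' : (2 : ℝ) ≤ j := by exact_mod_cast hj
  set e : ℝ := Real.exp η with he
  have he1 : 1 < e := Real.one_lt_exp_iff.2 hη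
  set B : ℝ := (2 * j : ℕ) * ((2 * j : ℕ) - 1) / 2 * (e ^ 2 - 1) with hB
  have hB0 : 0 < B := by
    have h1 : 0 < e ^ 2 - 1 := by nlinarith
    have h2 : (0 : ℝ) < (2 * j : ℕ) - 1 := by push_cast; linarith
    have h3 : (0 : ℝ) < (2 * j : ℕ) := by push_cast; linarith
    positivity
  have hX : Tendsto (fun n : ℕ => (n : ℝ) + 1 / 2) atTop atTop :=
    tendsto_atTop_add_const_right _ _ tendsto_natCast_atTop_atTop
  have hlim : Tendsto (fun n : ℕ => a / ((n : ℝ) + 1 / 2)) atTop (𝓝 0) :=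
    hX.const_div_atTop a
  have hz1 : ∀ᶠ n : ℕ in atTop, a / ((n : ℝ) + 1 / 2) * e ≤ 1 := by
    have := hlim.mul_const e
    rw [zero_mul] at this
    exact this.eventually_le_const one_pos
  have hz2 : ∀ᶠ n : ℕ in atTop, a / ((n : ℝ) + 1 / 2) * (C * (1 + e ^ 3)) ≤ B / 2 := by
    have := hlim.mul_const (C * (1 + e ^ 3))
    rw [zero_mul] at this
    exact this.eventually_le_const (by positivity)
  have hbig : ∀ᶠ n : ℕ in atTop, Real.pi ≤
      ((n : ℝ) + 1 / 2) ^ (2 * (j : ℝ) - 2 - 4 * s) * (a ^ 2 * (B / 2) * |t|) := by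
    have h1 := (tendsto_rpow_atTop (y := 2 * (j : ℝ) - 2 - 4 * s) (by linarith)).comp hX
    have h2 : 0 < a ^ 2 * (B / 2) * |t| := by positivity
    exact (h1.atTop_mul_const h2).eventually_ge_atTop Real.pi
  obtain ⟨n, hn1, hn2, hn3, hn4⟩ :=
    (hz1.and (hz2.and (hbig.and (eventually_ge_atTop 1)))).exists
  -- With `X = n + 1/2` and `z = A / X` the phase speed is `-X^{2j} Re (1 - i z e^h)^{2j}`, and
  -- `z → 0`, so that the expansion of second order in `z` determines the difference.
  set X : ℝ := (n : ℝ) + 1 / 2 with hXdef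
  have hn4' : (1 : ℝ) ≤ n := by exact_mod_cast hn4
  have hX0 : 0 < X := by positivity
  set A : ℝ := amplitude a s (n : ℤ) with hA
  have hA0 : 0 < A := amplitude_pos ha s n
  have hAa : A ≤ a := amplitude_le ha hs₀ n
  set z : ℝ := A / X with hz
  have hz0 : 0 < z := by positivity
  have hza : z ≤ a / X := by
    rw [hz]
    gcongr
  have hre : ∀ y : ℝ,
      ((((-(((n : ℤ) : ℝ) + 1 / 2) : ℝ) : ℂ) + (A * y : ℝ) * Complex.I) ^ (2 * j)).re
      = X ^ (2 * j) * ((1 - ((z * y : ℝ) : ℂ) * Complex.I) ^ (2 * j)).re := by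
    intro y
    rw [← Complex.re_ofReal_mul]
    congr 1
    have hXc : (X : ℂ) ≠ 0 := by exact_mod_cast hX0.ne'
    have h1 : (((-(((n : ℤ) : ℝ) + 1 / 2) : ℝ) : ℂ) + (A * y : ℝ) * Complex.I)
        = -((X : ℂ) * (1 - ((z * y : ℝ) : ℂ) * Complex.I)) := by
      have h2 : (A : ℂ) = X * z := by
        rw [hz]
        push_cast
        field_simp
      rw [Complex.ofReal_mul, Complex.ofReal_mul, h2, hXdef]
      push_cast
      ring
    rw [h1, Even.neg_pow (even_two_mul j), mul_pow]
    push_cast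
    ring
  -- `Φ h` is the phase difference at time `|t|`; it grows from `0` at `h = 0` to at least `π`.
  set Φ : ℝ → ℝ := fun h => |t| * (X ^ (2 * j) * ((1 - ((z * 1 : ℝ) : ℂ) * Complex.I) ^ (2 * j)).re
    - X ^ (2 * j) * ((1 - ((z * Real.exp h : ℝ) : ℂ) * Complex.I) ^ (2 * j)).re) with hΦ
  have hΦcont : Continuous Φ := by
    rw [hΦ]
    fun_prop
  have hΦ0 : Φ 0 = 0 := by simp [hΦ]
  have hΦη : Real.pi ≤ Φ η := by
    have h1 := (abs_le.1 (hC (z * 1) (by positivity) (by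
      rw [mul_one]
      nlinarith))).1
    have h2 := (abs_le.1 (hC (z * e) (by positivity) ((by gcongr : z * e ≤ a / X * e).trans
      hn1))).2
    have h3 : z ^ 2 * (B / 2) ≤ ((1 - ((z * 1 : ℝ) : ℂ) * Complex.I) ^ (2 * j)).re
        - ((1 - ((z * e : ℝ) : ℂ) * Complex.I) ^ (2 * j)).re := by
      have h4 : z * (C * (1 + e ^ 3)) ≤ B / 2 := le_trans (by gcongr) hn2
      have h5 : z ^ 2 * (z * (C * (1 + e ^ 3))) ≤ z ^ 2 * (B / 2) := by gcongr
      rw [hB] at h5 ⊢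
      linarith
    have h6 : X ^ (2 * (j : ℝ) - 2 - 4 * s) * a ^ 2 ≤ X ^ (2 * j) * z ^ 2 := by
      have hbr : √(1 + ((n : ℤ) : ℝ) ^ 2) ≤ X := by
        rw [Real.sqrt_le_left hX0.le, hXdef]
        push_cast
        nlinarith
      have h7 : a * X ^ (-(2 * s)) ≤ A := by
        rw [hA, amplitude]
        gcongr a * ?_
        exact Real.rpow_le_rpow_of_nonpos (zero_lt_one.trans_le (one_le_bracket n)) hbr
          (by linarith)
      have h8 : X ^ (2 * (j : ℝ) - 2 - 4 * s) = X ^ (2 * j) / X ^ 2 * (X ^ (-(2 * s))) ^ 2 := by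
        rw [← Real.rpow_natCast X (2 * j), ← Real.rpow_natCast X 2,
          ← Real.rpow_natCast (X ^ (-(2 * s))) 2, ← Real.rpow_mul hX0.le, ← Real.rpow_sub hX0,
          ← Real.rpow_add hX0]
        congr 1
        push_cast
        ring
      calc _ = X ^ (2 * j) / X ^ 2 * (a * X ^ (-(2 * s))) ^ 2 := by rw [h8]; ring
        _ ≤ X ^ (2 * j) / X ^ 2 * A ^ 2 := by gcongr
        _ = _ := by rw [hz]; field_simp
    calc Real.pi ≤ X ^ (2 * (j : ℝ) - 2 - 4 * s) * (a ^ 2 * (B / 2) * |t|) := hn3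
      _ = |t| * (B / 2) * (X ^ (2 * (j : ℝ) - 2 - 4 * s) * a ^ 2) := by ring
      _ ≤ |t| * (B / 2) * (X ^ (2 * j) * z ^ 2) := by gcongr
      _ = |t| * (X ^ (2 * j) * (z ^ 2 * (B / 2))) := by ring
      _ ≤ |t| * (X ^ (2 * j) * (((1 - ((z * 1 : ℝ) : ℂ) * Complex.I) ^ (2 * j)).re
        - ((1 - ((z * e : ℝ) : ℂ) * Complex.I) ^ (2 * j)).re)) := by gcongr
      _ = Φ η := by rw [hΦ, he]; ring
  obtain ⟨h, hh, hΦh⟩ := intermediate_value_Icc hη.le hΦcont.continuousOn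
    ⟨hΦ0.le.trans Real.pi_pos.le, hΦη⟩
  refine ⟨n, h, hh, ?_⟩
  rw [phaseSpeed, phaseSpeed, ← hA, hre, hre, Real.exp_zero]
  have hsign : Complex.exp (Complex.I * ((t * (X ^ (2 * j) *
      ((1 - ((z * 1 : ℝ) : ℂ) * Complex.I) ^ (2 * j)).re - X ^ (2 * j) *
        ((1 - ((z * Real.exp h : ℝ) : ℂ) * Complex.I) ^ (2 * j)).re) : ℝ) : ℂ)) = -1 := by
    simp only [hΦ] at hΦh
    rcases abs_choice t with h' | h' <;> rw [h'] at hΦh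
    · rw [hΦh, mul_comm, Complex.exp_pi_mul_I]
    · rw [show ∀ y : ℝ, t * y = -(-t * y) by intro y; ring, hΦh, Complex.ofReal_neg, mul_neg,
        mul_comm, Complex.exp_neg, Complex.exp_pi_mul_I]
      norm_num
  rw [← neg_one_mul (Complex.exp _), ← hsign, ← Complex.exp_add]
  congr 1
  push_cast
  ring

/-! ### Norms of soliton shapes -/

lemma enorm_sobolevMap_solitonShape (k : ℕ) (h θ b : ℝ) :
    ‖sobolevMap k (solitonShape h θ b)‖ₑ = ‖sobolevMap k (solitonShape h 0 0)‖ₑ := by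
  simp only [solitonShape, map_smul, enorm_smul, enorm_sobolevMap_translate, enorm_mul]
  congr 2
  rw [← ofReal_norm, ← ofReal_norm, mul_comm Complex.I, mul_comm Complex.I,
    Complex.norm_exp_ofReal_mul_I, Complex.norm_exp_ofReal_mul_I]

lemma continuous_solitonShape_zero : Continuous fun h => solitonShape h 0 0 := by
  have h1 : Continuous fun h : ℝ => Complex.exp (Complex.I * (0 : ℝ)) * Real.exp h := by
    fun_prop
  exact h1.smul ((translate 0).continuous.comp (continuous_dilate_exp sech))

lemma tendsto_enorm_sobolevMap_sub (k : ℕ) :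
    Tendsto (fun h => ‖sobolevMap k (solitonShape 0 0 0 - solitonShape h 0 0)‖ₑ) (𝓝 0) (𝓝 0) := by
  have h : Continuous fun h => ‖sobolevMap k (solitonShape 0 0 0 - solitonShape h 0 0)‖ₑ :=
    continuous_enorm.comp ((sobolevMap k).continuous.comp
      (continuous_const.sub continuous_solitonShape_zero))
  have h0 := h.tendsto 0
  simpa using h0

lemma eLpNorm_sech_pos : 0 < eLpNorm sech 2 volume := by
  rw [pos_iff_ne_zero, ne_eq, eLpNorm_eq_zero_iff sech.continuous.aestronglyMeasurable (by simp),
    Continuous.ae_eq_iff_eq volume sech.continuous continuous_zero]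
  intro h
  have := congrFun h 0
  simp [sech_apply] at this

/-- With opposite phases the two solitons add up, wherever they are. -/
lemma eLpNorm_sech_le_of_opposite {h θ θ' b b' : ℝ}
    (hθ : Complex.exp (Complex.I * θ') = -Complex.exp (Complex.I * θ)) :
    eLpNorm sech 2 volume ≤ eLpNorm (solitonShape 0 θ b - solitonShape h θ' b') 2 volume := by
  have h1 : eLpNorm (fun y => sech (y - b)) 2 volume = eLpNorm sech 2 volume :=
    eLpNorm_comp_measurePreserving sech.continuous.aestronglyMeasurable
      (measurePreserving_sub_right volume b)
  rw [← h1]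
  refine eLpNorm_mono fun y => ?_
  have h2 : (solitonShape 0 θ b - solitonShape h θ' b') y
      = Complex.exp (Complex.I * θ) * (((Real.cosh (y - b))⁻¹
        + Real.exp h * (Real.cosh (Real.exp h * (y - b')))⁻¹ : ℝ) : ℂ) := by
    rw [sub_apply, solitonShape_apply, solitonShape_apply, hθ, Real.exp_zero, one_mul]
    push_cast
    ring
  rw [h2, norm_mul, mul_comm Complex.I, Complex.norm_exp_ofReal_mul_I, one_mul, sech_apply,
    Complex.norm_real, Complex.norm_real, Real.norm_of_nonneg (inv_cosh_pos _).le,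
    Real.norm_of_nonneg (by positivity)]
  have := Real.exp_pos h
  have := inv_cosh_pos (Real.exp h * (y - b'))
  nlinarith [mul_pos (Real.exp_pos h) this]

end

section

open MeasureTheory Filter
open scoped Topology

/-! ### Failure of uniform continuity -/

lemma toDistribution_sub (f g : 𝓢(ℝ, ℂ)) :
    toDistribution f - toDistribution g = toDistribution (f - g) :=
  (map_sub (SchwartzMap.toTemperedDistributionCLM ℝ ℂ volume) f g).symm

/-- Amplitudes below the threshold leave half of the `L²` norm in the central frequency interval. -/
lemma exists_small_amplitude {C : ℝ} (hC : 0 < C) {M q : ℝ≥0∞} (hM0 : M ≠ 0) (hM : M ≠ ⊤)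
    (hq0 : q ≠ 0) (hq : q ≠ ⊤) :
    ∃ a : ℝ, 0 < a ∧ a ≤ 1 ∧ ∀ b ≤ a, ENNReal.ofReal (C * b) * (2 * M) ≤ q / 2 := by
  have hM' : 0 < M.toReal := ENNReal.toReal_pos hM0 hM
  have hq' : 0 < q.toReal := ENNReal.toReal_pos hq0 hq
  refine ⟨min 1 (q.toReal / (4 * C * M.toReal)), by positivity, min_le_left _ _, fun b hb => ?_⟩
  rw [← ENNReal.ofReal_toReal hM, ← ENNReal.ofReal_toReal hq,
    show (2 : ℝ≥0∞) = ENNReal.ofReal 2 by simp, ← ENNReal.ofReal_mul (by norm_num),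
    ← ENNReal.ofReal_mul' (by positivity), ← ENNReal.ofReal_div_of_pos (by norm_num)]
  refine ENNReal.ofReal_le_ofReal ?_
  have h1 := hb.trans (min_le_right _ _)
  rw [le_div_iff₀ (by positivity)] at h1
  linarith

/-- Solitons of the same high frequency that are close at time `0` and have opposite phases at
time `t`. -/
theorem exists_decoherent_solutions {j : ℕ} (hj : 2 ≤ j) {p : ℝ≥0∞} (hp : 1 ≤ p) {s : ℝ}
    (hs₀ : 0 ≤ s) (hs : s < ((j : ℝ) - 1) / 2) {ψ : ℝ → ℝ} (hψ : IsFrequencyCutoff ψ) :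
    ∃ c : Coefficients, IsNLSLike c ∧ ∃ R : ℝ≥0,
      ∀ t : ℝ, t ≠ 0 → ∃ ε : ℝ≥0∞, 0 < ε ∧ ∀ δ : ℝ≥0∞, 0 < δ →
        ∃ u v : ℝ → 𝓢(ℝ, ℂ),
          IsSchwartzSolution j c Set.univ u ∧ IsSchwartzSolution j c Set.univ v ∧
          (∀ τ : ℝ, modNorm ψ s p (toDistribution (u τ)) ≤ R ∧
            modNorm ψ s p (toDistribution (v τ)) ≤ R) ∧
          modNorm ψ s p (toDistribution (u 0) - toDistribution (v 0)) < δ ∧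
          ε ≤ modNorm ψ s p (toDistribution (u t) - toDistribution (v t)) := by
  obtain ⟨c, hc, hcF⟩ := exists_hierarchy_coefficients j
  obtain ⟨K, hK⟩ := exists_modNorm_wavePacket_le hψ hs₀ hp
  obtain ⟨C, hC0, hC⟩ := exists_le_modNorm_wavePacket hψ s hp
  generalize smoothnessIndex s = k at hK hC
  -- `M` bounds the shapes of all solitons with small `h`, at all times.
  obtain ⟨M, hMdef⟩ : ∃ M, M = ‖sobolevMap k (solitonShape 0 0 0)‖ₑ + 1 := ⟨_, rfl⟩
  have hMtop : M ≠ ⊤ := by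
    rw [hMdef]
    exact ENNReal.add_ne_top.2 ⟨enorm_ne_top, ENNReal.one_ne_top⟩
  have hM0 : M ≠ 0 := by simp [hMdef]
  have hqtop : eLpNorm sech 2 volume ≠ ⊤ := (sech.eLpNorm_lt_top 2 volume).ne
  obtain ⟨a, ha, ha1, hsmall⟩ := exists_small_amplitude hC0 hM0 hMtop eLpNorm_sech_pos.ne' hqtop
  have hupper : ∀ (n : ℤ) (r : 𝓢(ℝ, ℂ)), modNorm ψ s p (toDistribution
      (wavePacket (-(n + 1 / 2)) (amplitude a s n) (amplitude_pos ha s n).ne' r))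
      ≤ K * ENNReal.ofReal (√a) * ‖sobolevMap k r‖ₑ := by
    intro n r
    have h := hK n _ (amplitude_pos ha s n) ((amplitude_le ha hs₀ n).trans ha1) r
    rwa [ofReal_bracket_mul_amplitude ha] at h
  have hclose := tendsto_enorm_sobolevMap_sub k
  have hbound : ∀ h, ‖sobolevMap k (solitonShape 0 0 0 - solitonShape h 0 0)‖ₑ < 1 →
      ∀ θ b, ‖sobolevMap k (solitonShape h θ b)‖ₑ ≤ M := by
    intro h hh θ b
    rw [enorm_sobolevMap_solitonShape]
    have h1 : sobolevMap k (solitonShape h 0 0) = sobolevMap k (solitonShape 0 0 0)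
        - sobolevMap k (solitonShape 0 0 0 - solitonShape h 0 0) := by
      rw [map_sub, sub_sub_cancel]
    rw [h1, hMdef]
    exact enorm_sub_le.trans (add_le_add le_rfl hh.le)
  refine ⟨c, hc, K * (√a).toNNReal * M.toNNReal, fun t ht =>
    ⟨ENNReal.ofReal (√a) * (eLpNorm sech 2 volume / 2), ?_, fun δ hδ => ?_⟩⟩
  · exact ENNReal.mul_pos (by simpa using ha) (ENNReal.div_pos eLpNorm_sech_pos.ne' (by simp)).ne'
  have hev1 : ∀ᶠ h in 𝓝 (0 : ℝ),
      ‖sobolevMap k (solitonShape 0 0 0 - solitonShape h 0 0)‖ₑ < 1 :=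
    hclose.eventually_lt_const one_pos
  have hev2 : ∀ᶠ h in 𝓝 (0 : ℝ), K * ENNReal.ofReal (√a) *
      ‖sobolevMap k (solitonShape 0 0 0 - solitonShape h 0 0)‖ₑ < δ := by
    have h1 := ENNReal.Tendsto.const_mul hclose
      (Or.inr (ENNReal.mul_ne_top (ENNReal.coe_ne_top (r := K)) (ENNReal.ofReal_ne_top (r := √a))))
    rw [mul_zero] at h1
    exact h1.eventually_lt_const hδ
  -- Any `h` below `η` makes the initial distance small, uniformly in the frequency `n`, so that `n`
  -- may be chosen afterwards.
  obtain ⟨η, hη, hball⟩ := Metric.eventually_nhds_iff.1 (hev1.and hev2)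
  obtain ⟨n, h, hh, hphase⟩ := exists_opposite_phases hj hs₀ hs ha ht (half_pos hη)
  obtain ⟨hh1, hh2⟩ := hball (y := h) (by
    rw [dist_zero_right, Real.norm_of_nonneg hh.1]
    linarith [hh.2])
  set N : ℝ := -((n : ℝ) + 1 / 2)
  set A : ℝ := amplitude a s n
  have hA : 0 < A := amplitude_pos ha s n
  have hM_zero := hbound 0 (by simp)
  have hM_h := hbound h hh1
  have hR : ∀ r : 𝓢(ℝ, ℂ), ‖sobolevMap k r‖ₑ ≤ M →
      modNorm ψ s p (toDistribution (wavePacket N A hA.ne' r))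
        ≤ ((K * (√a).toNNReal * M.toNNReal : ℝ≥0) : ℝ≥0∞) := by
    intro r hr
    rw [ENNReal.coe_mul, ENNReal.coe_mul, ENNReal.coe_toNNReal hMtop]
    exact (hupper n r).trans (mul_le_mul_right hr _)
  have hu := isSchwartzSolution_soliton hcF N A hA.ne' 0
  have hv := isSchwartzSolution_soliton hcF N A hA.ne' h
  refine ⟨_, _, hu, hv, fun τ => ⟨?_, ?_⟩, ?_, ?_⟩
  · rw [soliton]
    exact hR _ (hM_zero _ _)
  · rw [soliton]
    exact hR _ (hM_h _ _)
  · rw [toDistribution_sub, soliton, soliton, ← map_sub]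
    simp only [mul_zero]
    exact (hupper n _).trans_lt hh2
  · rw [toDistribution_sub, soliton, soliton, ← map_sub]
    refine le_trans ?_ (hC n A hA _)
    rw [ofReal_bracket_mul_amplitude ha]
    gcongr
    have h1 := eLpNorm_sech_le_of_opposite (h := h)
      (b := A * (powCoeff N (A * Real.exp 0) (2 * j)).1 * t)
      (b' := A * (powCoeff N (A * Real.exp h) (2 * j)).1 * t) hphase
    have h2 : ∀ θ b θ' b', ENNReal.ofReal (C * A) *
        ‖sobolevMap k (solitonShape 0 θ b - solitonShape h θ' b')‖ₑ
        ≤ eLpNorm sech 2 volume / 2 := by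
      intro θ b θ' b'
      refine le_trans ?_ (hsmall A (amplitude_le ha hs₀ n))
      gcongr
      rw [map_sub, two_mul]
      exact enorm_sub_le.trans (add_le_add (hM_zero _ _) (hM_h _ _))
    -- The two solitons add up to at least the norm of one, and the part of it that leaves the
    -- frequency interval number `n` is at most half of that.
    calc eLpNorm sech 2 volume / 2
        = eLpNorm sech 2 volume - eLpNorm sech 2 volume / 2 :=
          (ENNReal.sub_half hqtop).symm
      _ ≤ _ := tsub_le_tsub h1 (h2 _ _ _ _)

lemma IsSchwartzSolution.mono {j : ℕ} {c : Coefficients} {I J : Set ℝ} {u : ℝ → 𝓢(ℝ, ℂ)}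
    (h : IsSchwartzSolution j c J u) (hIJ : I ⊆ J) : IsSchwartzSolution j c I u :=
  ⟨h.continuousOn.mono hIJ, fun t ht => h.differentiableAt t (hIJ ht),
    fun t ht => h.equation t (hIJ ht)⟩

end

end NLSHierarchy

end

theorem mainTheorem4 (j : ℕ) (hj : 2 ≤ j) (p : ℝ≥0∞) (hp : 2 ≤ p) (s : ℝ) (hs₀ : 0 ≤ s)
    (hs : s < ((j : ℝ) - 1) / 2) (ψ : ℝ → ℝ) (hψ : NLSHierarchy.IsFrequencyCutoff ψ) :
    ∃ c : NLSHierarchy.Coefficients, NLSHierarchy.IsNLSLike c ∧ ∃ R : ℝ≥0,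
      (∀ T : ℝ, 0 < T →
        ∀ S : NLSHierarchy.ModulationSpace ψ s p × Set.Ioo (-T) T →
            NLSHierarchy.ModulationSpace ψ s p,
          NLSHierarchy.IsFlowMap j c ψ s p T S →
            ∀ t : Set.Ioo (-T) T, (t : ℝ) ≠ 0 →
              ¬ NLSHierarchy.IsUniformlyContinuousOn ψ s p (fun a => S (a, t))
                {a | NLSHierarchy.modNorm ψ s p a.1 ≤ R}) ∧
      (∀ t : ℝ, t ≠ 0 → ∃ ε : ℝ≥0∞, 0 < ε ∧ ∀ δ : ℝ≥0∞, 0 < δ →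
        ∃ u v : ℝ → 𝓢(ℝ, ℂ),
          NLSHierarchy.IsSchwartzSolution j c Set.univ u ∧
          NLSHierarchy.IsSchwartzSolution j c Set.univ v ∧
          (∀ τ : ℝ,
            NLSHierarchy.modNorm ψ s p (NLSHierarchy.toDistribution (u τ)) ≤ R ∧
            NLSHierarchy.modNorm ψ s p (NLSHierarchy.toDistribution (v τ)) ≤ R) ∧
          NLSHierarchy.modNorm ψ s p
            (NLSHierarchy.toDistribution (u 0) - NLSHierarchy.toDistribution (v 0)) < δ ∧
          ε ≤ NLSHierarchy.modNorm ψ s p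
            (NLSHierarchy.toDistribution (u t) - NLSHierarchy.toDistribution (v t))) := by
  obtain ⟨c, hc, R, hR⟩ := NLSHierarchy.exists_decoherent_solutions hj (one_le_two.trans hp)
    hs₀ hs hψ
  refine ⟨c, hc, R, fun T hT S hS t ht hunif => ?_, hR⟩
  obtain ⟨ε, hε, hsol⟩ := hR t ht
  obtain ⟨δ, hδ, hδε⟩ := hunif ε hε
  obtain ⟨u, v, hu, hv, hbound, hinit, hfinal⟩ := hsol δ hδ
  let a : NLSHierarchy.ModulationSpace ψ s p :=
    ⟨NLSHierarchy.toDistribution (u 0), (hbound 0).1.trans_lt ENNReal.coe_lt_top⟩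
  let b : NLSHierarchy.ModulationSpace ψ s p :=
    ⟨NLSHierarchy.toDistribution (v 0), (hbound 0).2.trans_lt ENNReal.coe_lt_top⟩
  have h := hδε a (hbound 0).1 b (hbound 0).2 hinit
  rw [hS u (hu.mono (Set.subset_univ _)) a rfl t, hS v (hv.mono (Set.subset_univ _)) b rfl t] at h
  exact absurd hfinal (not_le.2 h)
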